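/- **Model.** Let $\mathcal{E}$ be the finite set of lanes (arcs $(i,j)$, self-loops allowed) of a transportation network. For each lane $(i,j)\in\mathcal{E}$ the following are given. * A set of admissible shipper prices and on it a strictly decreasing demand function $d_{ij}(\cdot)\ge 0$, with inverse $r_{ij}(\cdot)$ defined on the set $\mathcal{D}_{ij}$ of attainable demand rates; $\mathcal{D}_{ij}$ is an interval and $d\mapsto r_{ij}(d)\,d$ is concave on it. * A unit penalty $b_{ij}\in\mathbb{R}$, a carrier arrival rate $\lambda_{ij}>0$, and a staying probability $q_{ij}\ge 0$, with $\sum_{k:(j,k)\in\mathcal{E}}q_{jk}\le 1$ for every node $j$. * A density $f_{ij}$ of carriers' opportunity costs, with distribution function $F_{ij}$, such that $\{f_{ij}>0\}$ is an interval contained in $[0,\infty)$, the virtual cost $\psi_{ij}(c)=c+F_{ij}(c)/f_{ij}(c)$ is strictly increasing on it, and $(x_1,x_2)\mapsto F_{ij}^{-1}(x_1/x_2)\,x_1$ is convex on $0\le x_1<x_2$. In period $t$ the state is $(\mathbf{S}_t,\mathbf{D}_t)$, where $S_{ijt}$ carriers and $D_{ijt}$ loads are available on lane $(i,j)$. A stationary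 policy $\pi$ maps the state to admissible shipper prices $r_{ijt}$ and to a direct carrier-side mechanism: as a function of the bids of all available carriers on all lanes, a lottery over the sets of carriers who are given a load on their lane (never more carriers on a lane than loads), so that carrier $s$ is given a load with probability $A^s$, and an expected payment $P^s$ to each carrier (measurable, and integrable both under truthful reporting and for any fixed own bid with the others truthful). The carriers' true costs are independent, with density $f_{ij}$ on lane $(i,j)$. Let $a^s(c)$ and $p^s(c)$ be the expectations of $A^s$ and $P^s$ when carrier $s$ bids $c$ and all others bid truthfully. The policy is incentive compatible (IC) if in every state, for every carrier $s$ on any lane $(i,j)$ and every true cost $C$ with $f_{ij}(C)>0$, $p^s(C)-a^s(C)C\ge p^s(c)-a^s(c)C$ for all bids $c\in\mathbb{R}$, and individually rational (IR) if $p^s(C)-a^s(C)C\ge 0$. The demand rates $d_{ij}(r_{ijt})$ that $\pi$ sets are assumed to be bounded over all states. Let $Y_{ijt}$ be the number of carriers on lane $(i,j)$ who are given a load and $P_{ijt}$ the total payment on the lane, under truthful reporting. Each of the $Y_{kit}$ carriers arriving at node $i$ independently becomes available on lane $(i,j)$ in the next period with probability $q_{ij}$ and otherwise leaves, which gives $Z_{ijt}$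 carriers on lane $(i,j)$; carriers who are given no load leave. Then $S_{ij,t+1}=Z_{ijt}+\Lambda_{ij,t+1}$ with $\Lambda_{ij,t+1}\sim\mathrm{Poisson}(\lambda_{ij})$, and $D_{ij,t+1}\sim\mathrm{Poisson}(d_{ij}(r_{ijt}))$, all independent given the past. The one-period expected profit is $$G^\pi(\mathbf{S}_t,\mathbf{D}_t)=\mathrm{E}\Big[\sum_{(i,j)\in\mathcal{E}} r_{ijt}d_{ij}(r_{ijt})-b_{ij}(D_{ijt}-Y_{ijt})-P_{ijt}\,\Big|\,\mathbf{S}_t,\mathbf{D}_t\Big].$$ **Fluid program (FA).** Maximize $$\sum_{(i,j)\in\mathcal{E}} r_{ij}(d_{ij})d_{ij}-F_{ij}^{-1}\Big(\frac{\bar y_{ij}}{\bar\lambda_{ij}}\Big)\bar y_{ij}-b_{ij}(d_{ij}-\bar y_{ij})$$ over $d_{ij},\bar y_{ij},\bar\lambda_{ij}\ge 0$ subject to $\sum_{k:(k,i)\in\mathcal{E}}q_{ij}\bar y_{ki}+\lambda_{ij}=\bar\lambda_{ij}$, $\bar y_{ij}\le d_{ij}$ and $\bar y_{ij}\le\bar\lambda_{ij}$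 for all $(i,j)\in\mathcal{E}$, where $d_{ij}\in\mathcal{D}_{ij}$ and $\bar y_{ij}/\bar\lambda_{ij}$ lies in the range of $F_{ij}$ (so that the objective is defined). **Theorem.** For every stationary policy $\pi$ as above that is IC and IR, and every initial law of $(\mathbf{S}_1,\mathbf{D}_1)$ with finite means (in particular every initial state), the long-run average profit satisfies $$\limsup_{T\to\infty}\frac1T\sum_{t=1}^{T}\mathrm{E}\big[G^\pi(\mathbf{S}_t,\mathbf{D}_t)\big]\;\le\;\gamma^{\mathsf{FA}},$$ where $\gamma^{\mathsf{FA}}\in(-\infty,+\infty]$ is the optimal value (supremum) of (FA), and the expectations are taken in $[-\infty,\infty)$. In particular, the bound holds for $\gamma^\pi=\lim_{T\to\infty}\frac1T\sum_{t=1}^T\mathrm{E}[G^\pi(\mathbf{S}_t,\mathbf{D}_t)]$ whenever the limit exists. -/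

import Mathlib

open MeasureTheory ProbabilityTheory Filter Set

noncomputable section

namespace Freight

/-- The lanes (origin-destination pairs) of a network: the arcs `(i, j)` in the finite set `E`.
Self-loops are allowed. -/
abbrev Lane {N : Type*} (E : Finset (N × N)) : Type _ := {e : N × N // e ∈ E}

/-- The law on `ℝ` with density `f`. -/
def densityLaw (f : ℝ → ℝ) : Measure ℝ := volume.withDensity (fun c => ENNReal.ofReal (f c))

/-- The distribution function of the law with density `f`. -/
def distFun (f : ℝ → ℝ) (c : ℝ) : ℝ := (densityLaw f).real (Iic c)

/-- The inverse of the distribution function of the law with density `f`. -/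
def invDistFun (f : ℝ → ℝ) (u : ℝ) : ℝ := sInf {c : ℝ | u ≤ distFun f c}

/-- The virtual cost function `ψ(c) = c + F(c) / f(c)`. -/
def virtualCost (f : ℝ → ℝ) (c : ℝ) : ℝ := c + distFun f c / f c

/-- The primitives of the freight marketplace on the network with arc set `E`. -/
structure Market {N : Type*} [DecidableEq N] (E : Finset (N × N)) where
  /-- Admissible shipper prices on each lane (the domain of the demand function). -/
  prices : Lane E → Set ℝ
  /-- Demand rate of a lane as a function of the shipper price. -/
  demand : Lane E → ℝ → ℝ
  /-- Unit penalty for an unmatched load. -/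
  penalty : Lane E → ℝ
  /-- Rate of the Poisson stream of new carriers. -/
  arrival : Lane E → ℝ
  /-- `stay (j, k)`: probability that a carrier who has just arrived at `j` with a load stays and
  becomes available on the lane `(j, k)` in the next period. -/
  stay : Lane E → ℝ
  /-- Density of a carrier's opportunity cost on a lane. -/
  density : Lane E → ℝ → ℝ
  demand_nonneg : ∀ l, ∀ r ∈ prices l, 0 ≤ demand l r
  demand_strictAnti : ∀ l, StrictAntiOn (demand l) (prices l)
  /-- The revenue `r(d) d` is a concave function of the demand rate `d`, where `r` is the inverse
  demand function; in particular the attainable demand rates form an interval. -/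
  revenue_concave : ∀ l, ConcaveOn ℝ (demand l '' prices l)
    (fun d => Function.invFunOn (demand l) (prices l) d * d)
  arrival_pos : ∀ l, 0 < arrival l
  stay_nonneg : ∀ l, 0 ≤ stay l
  stay_sum_le : ∀ j : N, ∑ l : Lane E, (if l.1.1 = j then stay l else 0) ≤ 1
  density_measurable : ∀ l, Measurable (density l)
  density_nonneg : ∀ l c, 0 ≤ density l c
  density_lintegral : ∀ l, ∫⁻ c, ENNReal.ofReal (density l c) = 1
  /-- The costs with positive density form an interval ... -/
  density_interval : ∀ l, {c | 0 < density l c}.OrdConnected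
  /-- ... of nonnegative numbers. -/
  cost_nonneg : ∀ l c, 0 < density l c → 0 ≤ c
  /-- Regularity: the virtual cost is strictly increasing. -/
  virtualCost_strictMono : ∀ l, StrictMonoOn (virtualCost (density l)) {c | 0 < density l c}
  /-- `F⁻¹(x₁ / x₂) x₁` is jointly convex. -/
  payment_convex : ∀ l, ConvexOn ℝ {x : ℝ × ℝ | 0 ≤ x.1 ∧ x.1 < x.2}
    (fun x => invDistFun (density l) (x.1 / x.2) * x.1)

variable {N : Type*} [DecidableEq N] {E : Finset (N × N)}

/-- System states `(S, D)`: numbers of available carriers and of loads on every lane. -/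
abbrev State (E : Finset (N × N)) : Type _ := (Lane E → ℕ) × (Lane E → ℕ)

/-- The carriers available in state `x`: a lane together with an index `s < S`. -/
abbrev Carrier (x : State E) : Type _ := Σ l : Lane E, Fin (x.1 l)

/-- Bid profiles: one bid for every available carrier, on all lanes. -/
abbrev Bids (x : State E) : Type _ := Carrier x → ℝ

/-- Realized allocations: `W k = true` iff the carrier `k` is given a load on its lane. -/
abbrev Outcome (x : State E) : Type _ := Carrier x → Bool

/-- `Y`: the number of carriers who transport a load on each lane. -/
def shipped {x : State E} (W : Outcome x) (l : Lane E) : ℕ :=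
  (Finset.univ.filter (fun s : Fin (x.1 l) => W ⟨l, s⟩ = true)).card

/-- A stationary policy. It maps every state to shipper prices and to a direct carrier-side
mechanism, i.e. a lottery over allocations and expected payments, as functions of the bids. -/
structure Policy (E : Finset (N × N)) where
  price : State E → Lane E → ℝ
  lottery : (x : State E) → Kernel (Bids x) (Outcome x)
  payment : (x : State E) → Carrier x → Bids x → ℝ

namespace Market

variable (M : Market E)

/-- The law of the opportunity cost of a carrier on lane `l`. -/
def costLaw (l : Lane E) : Measure ℝ := densityLaw (M.density l)

/-- The distribution function `F` of the opportunity cost on lane `l`. -/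
def F (l : Lane E) (c : ℝ) : ℝ := distFun (M.density l) c

/-- The inverse distribution function `F⁻¹` of the opportunity cost on lane `l`. -/
def invF (l : Lane E) (u : ℝ) : ℝ := invDistFun (M.density l) u

/-- The inverse demand function `r(d)`. -/
def invDemand (l : Lane E) (d : ℝ) : ℝ := Function.invFunOn (M.demand l) (M.prices l) d

/-- The joint law of the (independent) opportunity costs of all carriers in state `x`. -/
def profileLaw (x : State E) : Measure (Bids x) := Measure.pi (fun k => M.costLaw k.1)

/-! ### Mechanisms -/

/-- `A^k(c)`: the probability that carrier `k` is given a load under the bid profile `c`. -/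
def allocProb (π : Policy E) (x : State E) (k : Carrier x) (c : Bids x) : ℝ :=
  (π.lottery x c).real {W | W k = true}

/-- `a^k(c)`: the probability that carrier `k` is given a load if he bids `c` and all other
carriers report truthfully (the `k`-th entry of the random profile is overwritten). -/
def interimAlloc (π : Policy E) (x : State E) (k : Carrier x) (c : ℝ) : ℝ :=
  ∫ C, allocProb π x k (Function.update C k c) ∂M.profileLaw x

/-- `p^k(c)`: the expected payment to carrier `k` if he bids `c` and all other carriers report
truthfully. -/
def interimPayment (π : Policy E) (x : State E) (k : Carrier x) (c : ℝ) : ℝ :=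
  ∫ C, π.payment x k (Function.update C k c) ∂M.profileLaw x

/-- Bayesian incentive compatibility in every state: whatever his true cost `C`, no carrier gains
by a bid `c` different from `C`. -/
def IsIC (π : Policy E) : Prop :=
  ∀ (x : State E) (k : Carrier x) (C : ℝ), 0 < M.density k.1 C → ∀ c : ℝ,
    M.interimPayment π x k c - M.interimAlloc π x k c * C
      ≤ M.interimPayment π x k C - M.interimAlloc π x k C * C

/-- Individual rationality in every state. -/
def IsIR (π : Policy E) : Prop :=
  ∀ (x : State E) (k : Carrier x) (C : ℝ), 0 < M.density k.1 C →
    0 ≤ M.interimPayment π x k C - M.interimAlloc π x k C * C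

/-- The well-posed stationary policies. -/
structure IsPolicy (π : Policy E) : Prop where
  price_mem : ∀ x l, π.price x l ∈ M.prices l
  /-- The demand rates set by the policy stay bounded. -/
  demand_bounded : ∃ B : ℝ, ∀ x l, M.demand l (π.price x l) ≤ B
  lottery_markov : ∀ x, IsMarkovKernel (π.lottery x)
  /-- No lane is given more carriers than it has loads. -/
  shipped_le : ∀ x c l, ∀ᵐ W ∂π.lottery x c, shipped W l ≤ x.2 l
  payment_measurable : ∀ x k, Measurable (π.payment x k)
  payment_integrable : ∀ x k, Integrable (π.payment x k) (M.profileLaw x)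
  interimPayment_integrable : ∀ x k (c : ℝ),
    Integrable (fun C => π.payment x k (Function.update C k c)) (M.profileLaw x)

/-! ### The controlled Markov chain -/

/-- The law of the realized allocation in state `x` when all carriers report truthfully. -/
def outcomeLaw (π : Policy E) (x : State E) : Measure (Outcome x) :=
  (M.profileLaw x).bind (π.lottery x)

/-- What one carrier who has just arrived at node `j` adds to the supply of the next period: one
unit on the lane `l` out of `j` with probability `stay l`, nothing if he leaves. -/
def moveLaw (j : N) : Measure (Lane E → ℕ) :=
  ENNReal.ofReal (1 - ∑ l : Lane E, if l.1.1 = j then M.stay l else 0) • Measure.dirac 0 +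
    ∑ l : Lane E, (if l.1.1 = j then ENNReal.ofReal (M.stay l) else 0) •
      Measure.dirac (Pi.single l 1)

/-- The law of `Z` given that `Y` carriers shipped loads. They move independently, so that for
every node `i` the vector `(Z_ij)_j` is multinomial with parameters `∑_k Y_ki` and `(q_ij)_j`. -/
def stayLaw (Y : Lane E → ℕ) : Measure (Lane E → ℕ) :=
  (Measure.pi (fun k : (Σ l : Lane E, Fin (Y l)) => M.moveLaw k.1.1.2)).map (fun m => ∑ k, m k)

/-- The law of independent Poisson variables with the given rates. -/
def poissonLaw (rate : Lane E → ℝ) : Measure (Lane E → ℕ) :=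
  Measure.pi (fun l => poissonMeasure (rate l).toNNReal)

/-- One-step transition law `(S, D) ↦ (Z + Λ, D')`. -/
def step (π : Policy E) (x : State E) : Measure (State E) :=
  (((M.outcomeLaw π x).bind (fun W => M.stayLaw (shipped W))).prod
    ((poissonLaw M.arrival).prod
      (poissonLaw (fun l => M.demand l (π.price x l))))).map
    (fun w => (w.1 + w.2.1, w.2.2))

/-- The law of the state after `t` steps from the initial law `ν`. -/
def stateLaw (π : Policy E) (ν : Measure (State E)) : ℕ → Measure (State E)
  | 0 => ν
  | t + 1 => (stateLaw π ν t).bind (M.step π)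

/-- `E[Y | S, D]`. -/
def meanShipped (π : Policy E) (x : State E) (l : Lane E) : ℝ :=
  ∫ W, (shipped W l : ℝ) ∂M.outcomeLaw π x

/-- `E[P | S, D]`: the expected total payment to the carriers on a lane. -/
def meanPayment (π : Policy E) (x : State E) (l : Lane E) : ℝ :=
  ∫ C, ∑ s : Fin (x.1 l), π.payment x ⟨l, s⟩ C ∂M.profileLaw x

/-- `G(S, D)`: the expected profit of one period. -/
def profit (π : Policy E) (x : State E) : ℝ :=
  ∑ l : Lane E, (π.price x l * M.demand l (π.price x l)
    - M.penalty l * (x.2 l - M.meanShipped π x l) - M.meanPayment π x l)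

/-- The expectation `E[f⁺] - E[f⁻]` in the extended reals, so that a function with integrable
positive part and non-integrable negative part has expectation `-∞`. -/
def extExpectation {α : Type*} [MeasurableSpace α] (μ : Measure α) (f : α → ℝ) : EReal :=
  ((∫⁻ x, ENNReal.ofReal (f x) ∂μ : ENNReal) : EReal)
    - ((∫⁻ x, ENNReal.ofReal (-f x) ∂μ : ENNReal) : EReal)

/-- Expected profit per period over the first `T` periods. -/
def averageProfit (π : Policy E) (ν : Measure (State E)) (T : ℕ) : EReal :=
  (∑ t ∈ Finset.range T, extExpectation (M.stateLaw π ν t) (M.profit π)) / ((T : ℝ) : EReal)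

/-- The long-run average profit. It is taken as an upper limit, which is the limit whenever the
latter exists. -/
def longRunProfit (π : Policy E) (ν : Measure (State E)) : EReal :=
  limsup (M.averageProfit π ν) atTop

/-! ### The fluid program -/

/-- Feasible points `(d, y, lam)` of the fluid program, where `d` lies in the domain of the inverse
demand function and `y / lam` in the domain of `F⁻¹`. -/
structure FAFeasible (d y lam : Lane E → ℝ) : Prop where
  flow : ∀ l : Lane E,
    (∑ k : Lane E, if k.1.2 = l.1.1 then M.stay l * y k else 0) + M.arrival l = lam l
  y_le_d : ∀ l, y l ≤ d l
  y_le_lam : ∀ l, y l ≤ lam l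
  y_nonneg : ∀ l, 0 ≤ y l
  lam_nonneg : ∀ l, 0 ≤ lam l
  d_nonneg : ∀ l, 0 ≤ d l
  d_mem : ∀ l, d l ∈ M.demand l '' M.prices l
  ratio_mem : ∀ l, y l / lam l ∈ Set.range (M.F l)

/-- The objective of the fluid program. -/
def FAObjective (d y lam : Lane E → ℝ) : ℝ :=
  ∑ l : Lane E, (M.invDemand l (d l) * d l - M.invF l (y l / lam l) * y l
    - M.penalty l * (d l - y l))

/-- The optimal value of the fluid program. -/
def FAValue : EReal :=
  sSup {v : EReal | ∃ d y lam : Lane E → ℝ, M.FAFeasible d y lam ∧ v = M.FAObjective d y lam}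

end Market

end Freight

end

noncomputable section

namespace Freight

/-! ### Subgradients and the envelope inequality -/

/-! The one-period profit is bounded, at every state, by an affine function of supplies, loads,
demand rates and mean shipments. The expectation of such a bound depends only on means, and the
time-averaged means nearly satisfy the constraints of the fluid program.

Payments. By incentive compatibility the interim utility `U(c) = p(c) - a(c) c` has `-a(c)` as a
subgradient, so with individual rationality it is at least the integral of `a` over the costs above
`c`. Integrating against `f` and exchanging the order gives `E[p] ≥ E[a ψ]`. As `ψ` increases and `0
≤ a ≤ 1`, comparison with the cutoff rule at `z` yields `E[p] ≥ ψ(z) (E[a] - F(z)) + z F(z)`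
(`tangent_le_integral_payment`). Summed over a lane, this is linear in mean shipments and supply,
with `z` free; `z` is taken as the quantile at the fluid matching ratio
(`exists_affine_le_meanPayment`).

Revenue. The concave `r(d) d` lies below a supporting line at the mean demand rate
(`exists_supporting_line_integral`).

Balance. Let `μ` be the average of the state laws over `T` periods. The mean next supply is the
inflow from mean shipments and the mean next load is the mean demand rate, so telescoping leaves
errors `O(1/T)`. Shrinking the mean shipments by `O(1/T)` restores exact feasibility, because the
positive arrival rates provide slack (`faFeasible_shrink`). Hence the average profit is at most a
feasible fluid objective plus `O(1/T)` (`averageProfit_le_FAObjective`), and `T → ∞` concludes. -/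

theorem antitoneOn_of_subgradient {I : Set ℝ} {U a : ℝ → ℝ}
    (h : ∀ c ∈ I, ∀ C ∈ I, U C + a C * (C - c) ≤ U c) : AntitoneOn a I := by
  intro c hc C hC hcC
  rcases hcC.eq_or_lt with rfl | hlt
  · exact le_rfl
  · have h1 := h c hc C hC
    have h2 := h C hC c hc
    by_contra! hlt'
    nlinarith [mul_pos (sub_pos.2 hlt) (sub_pos.2 hlt')]

/-- On a uniform partition the subgradient inequalities, taken at right endpoints, telescope to `U c
- U C`. Since `a` is antitone with values in `[0, 1]`, its integral exceeds the right-endpoint sum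
by at most one mesh width. No differentiability of `U` is involved. -/
theorem intervalIntegral_le_sub_of_subgradient {I : Set ℝ} (hI : I.OrdConnected) {U a : ℝ → ℝ}
    (h : ∀ c ∈ I, ∀ C ∈ I, U C + a C * (C - c) ≤ U c)
    (ha0 : ∀ c ∈ I, 0 ≤ a c) (ha1 : ∀ c ∈ I, a c ≤ 1)
    {c C : ℝ} (hc : c ∈ I) (hC : C ∈ I) (hcC : c ≤ C) :
    ∫ x in c..C, a x ≤ U c - U C := by
  have hanti := antitoneOn_of_subgradient h
  have hsub : Icc c C ⊆ I := hI.out hc hC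
  have key : ∀ n : ℕ, ∫ x in c..C, a x ≤ U c - U C + (C - c) / ((n : ℝ) + 1) := by
    intro n
    set m : ℕ := n + 1 with hm
    have hmpos : (0 : ℝ) < m := by rw [hm]; positivity
    set w : ℝ := (C - c) / m with hw
    have hw0 : 0 ≤ w := div_nonneg (sub_nonneg.2 hcC) hmpos.le
    have hwm : w * m = C - c := div_mul_cancel₀ _ hmpos.ne'
    have hmem : ∀ x : ℝ, 0 ≤ x → x ≤ m → c + w * x ∈ I := by
      intro x hx0 hxm
      refine hsub ⟨by nlinarith [mul_nonneg hw0 hx0], ?_⟩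
      nlinarith [mul_le_mul_of_nonneg_left hxm hw0]
    have hg : AntitoneOn (fun x => a (c + w * x)) (Icc (0 : ℝ) (0 + m)) := by
      intro x hx y hy hxy
      rw [zero_add] at hx hy
      exact hanti (hmem x hx.1 hx.2) (hmem y hy.1 hy.2)
        (by nlinarith [mul_le_mul_of_nonneg_left hxy hw0])
    have h1 := hg.integral_le_sum
    have h2 : w * ∫ x in (0 : ℝ)..(0 + m), a (c + w * x) = ∫ x in c..C, a x := by
      rw [intervalIntegral.mul_integral_comp_add_mul]
      congr 1
      · ring
      · rw [zero_add, hwm]; ring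
    have h3 : ∑ i ∈ Finset.range m, w * a (c + w * ((i : ℝ) + 1)) ≤ U c - U C := by
      have : ∀ i ∈ Finset.range m, w * a (c + w * ((i : ℝ) + 1)) ≤
          U (c + w * (i : ℕ)) - U (c + w * ((i + 1 : ℕ) : ℝ)) := by
        intro i hi
        have hi' : (i : ℝ) + 1 ≤ m := by exact_mod_cast Finset.mem_range.1 hi
        have := h (c + w * i) (hmem i (by positivity) (by linarith)) (c + w * (i + 1))
          (hmem _ (by positivity) hi')
        push_cast
        nlinarith
      refine (Finset.sum_le_sum this).trans ?_
      rw [Finset.sum_range_sub' (fun i : ℕ => U (c + w * (i : ℝ)))]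
      simp only [Nat.cast_zero, mul_zero, add_zero, hwm]
      rw [show c + (C - c) = C by ring]
    -- Left and right Riemann sums differ only in their end terms, `a c - a C ≤ 1`.
    have h4 : ∑ i ∈ Finset.range m, a (c + w * (0 + (i : ℝ))) ≤
        1 + ∑ i ∈ Finset.range m, a (c + w * ((i : ℝ) + 1)) := by
      have e := Finset.sum_range_succ' (fun i : ℕ => a (c + w * (i : ℝ))) m
      rw [Finset.sum_range_succ] at e
      simp only [zero_add]
      push_cast at e
      have := ha0 _ (hmem m (by positivity) le_rfl)
      have := ha1 _ (hmem 0 le_rfl hmpos.le)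
      linarith
    rw [← Finset.mul_sum] at h3
    have h5 := mul_le_mul_of_nonneg_left (h1.trans h4) hw0
    rw [h2] at h5
    have : (C - c) / ((n : ℝ) + 1) = w := by rw [hw, hm]; push_cast; rfl
    rw [this]
    nlinarith
  refine ge_of_tendsto' (f := fun n : ℕ => U c - U C + (C - c) / ((n : ℝ) + 1)) (x := atTop) ?_ key
  have h0 : Tendsto (fun n : ℕ => (1 : ℝ) / ((n : ℝ) + 1)) atTop (nhds 0) :=
    tendsto_one_div_add_atTop_nhds_zero_nat
  have := (h0.const_mul (C - c)).const_add (U c - U C)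
  simpa [div_eq_mul_inv] using this

/-- The interval may be unbounded or lack its right endpoint, so it is exhausted by `Icc c (u n)`
with `u n` cofinal in `I`; on each piece the term `U (u n) ≥ 0` is dropped. This is the information
rent bound. -/
theorem setLIntegral_le_of_subgradient {I : Set ℝ} (hI : I.OrdConnected) {U a : ℝ → ℝ}
    (h : ∀ c ∈ I, ∀ C ∈ I, U C + a C * (C - c) ≤ U c)
    (ha0 : ∀ c ∈ I, 0 ≤ a c) (ha1 : ∀ c ∈ I, a c ≤ 1) (hU : ∀ c ∈ I, 0 ≤ U c)
    {c : ℝ} (hc : c ∈ I) :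
    ∫⁻ x in I ∩ Ici c, ENNReal.ofReal (a x) ≤ ENNReal.ofReal (U c) := by
  have hanti := antitoneOn_of_subgradient h
  have := hI
  have : Nonempty I := ⟨⟨c, hc⟩⟩
  obtain ⟨u, hu, hut⟩ := exists_seq_monotone_tendsto_atTop_atTop I
  have hcov : I ∩ Ici c ⊆ ⋃ n, Icc c (u n : ℝ) := by
    rintro x ⟨hx, hcx⟩
    obtain ⟨n, hn⟩ := (hut.eventually_ge_atTop ⟨x, hx⟩).exists
    exact mem_iUnion.2 ⟨n, hcx, hn⟩
  have hdir : Directed (· ⊆ ·) (fun n => Icc c (u n : ℝ)) :=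
    Monotone.directed_le (fun m n hmn => Icc_subset_Icc le_rfl (hu hmn))
  refine (lintegral_mono_set hcov).trans ?_
  rw [setLIntegral_iUnion_of_directed _ hdir]
  refine iSup_le fun n => ?_
  rcases lt_or_ge (u n : ℝ) c with hlt | hle
  · simp [Icc_eq_empty_of_lt hlt]
  have hsub : Icc c (u n : ℝ) ⊆ I := hI.out hc (u n).2
  have hint_a : IntegrableOn a (Icc c (u n : ℝ)) :=
    (hanti.mono hsub).integrableOn_isCompact isCompact_Icc
  rw [← ofReal_integral_eq_lintegral_ofReal hint_a
    ((ae_restrict_iff' measurableSet_Icc).2 (ae_of_all _ fun x hx => ha0 x (hsub hx)))]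
  refine ENNReal.ofReal_le_ofReal ?_
  rw [integral_Icc_eq_integral_Ioc, ← intervalIntegral.integral_of_le hle]
  have := intervalIntegral_le_sub_of_subgradient hI h ha0 ha1 hc (u n).2 hle
  linarith [hU _ (u n).2]

/-! ### Distribution functions of densities -/

theorem isProbabilityMeasure_densityLaw {f : ℝ → ℝ} (h : ∫⁻ c, ENNReal.ofReal (f c) = 1) :
    IsProbabilityMeasure (densityLaw f) :=
  ⟨by rw [densityLaw, withDensity_apply _ MeasurableSet.univ, Measure.restrict_univ, h]⟩

theorem ofReal_distFun {f : ℝ → ℝ} (h : ∫⁻ c, ENNReal.ofReal (f c) = 1) (c : ℝ) :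
    ENNReal.ofReal (distFun f c) = ∫⁻ x in Iic c, ENNReal.ofReal (f x) := by
  have := isProbabilityMeasure_densityLaw h
  rw [distFun, ofReal_measureReal, densityLaw, withDensity_apply _ measurableSet_Iic]

theorem lintegral_densityLaw {f : ℝ → ℝ} (hf : Measurable f) {g : ℝ → ENNReal}
    (hg : Measurable g) :
    ∫⁻ c, g c ∂densityLaw f = ∫⁻ c in {c | 0 < f c}, ENNReal.ofReal (f c) * g c := by
  rw [densityLaw, lintegral_withDensity_eq_lintegral_mul _ hf.ennreal_ofReal hg]
  rw [← lintegral_indicator (measurableSet_lt measurable_const hf)]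
  refine lintegral_congr fun c => ?_
  by_cases hc : 0 < f c
  · simp [indicator, hc]
  · simp [indicator, hc, ENNReal.ofReal_of_nonpos (not_lt.1 hc)]

/-- Tonelli on the region `c ≤ x`, with `F(x)` written as the integral of `f` up to `x`. It turns
the expected information rent into the `F / f` part of the virtual cost. -/
theorem setLIntegral_mul_distFun {f : ℝ → ℝ} (hf : Measurable f)
    (h : ∫⁻ c, ENNReal.ofReal (f c) = 1) {g : ℝ → ENNReal} (hg : Measurable g) :
    ∫⁻ x in {c | 0 < f c}, g x * ENNReal.ofReal (distFun f x) =
      ∫⁻ c in {c | 0 < f c}, ENNReal.ofReal (f c) * ∫⁻ x in {c | 0 < f c} ∩ Ici c, g x := by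
  have hI : MeasurableSet {c | 0 < f c} := measurableSet_lt measurable_const hf
  have e1 : ∀ x, g x * ENNReal.ofReal (distFun f x) =
      ∫⁻ c in {c | 0 < f c}, {p : ℝ × ℝ | p.2 ≤ p.1}.indicator
        (fun p => ENNReal.ofReal (f p.2) * g p.1) (x, c) := by
    intro x
    rw [ofReal_distFun h, ← lintegral_const_mul _ hf.ennreal_ofReal,
      ← lintegral_indicator measurableSet_Iic, ← lintegral_indicator hI]
    refine lintegral_congr fun c => ?_
    by_cases hc : 0 < f c <;> by_cases hcx : c ≤ x <;>
      simp [indicator, hc, hcx, mul_comm, ENNReal.ofReal_of_nonpos (not_lt.1 _)]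
  simp_rw [e1]
  rw [lintegral_lintegral_swap]
  · refine lintegral_congr fun c => ?_
    rw [← lintegral_const_mul _ hg, Set.inter_comm, ← Measure.restrict_restrict measurableSet_Ici,
      ← lintegral_indicator measurableSet_Ici]
    refine lintegral_congr fun x => ?_
    by_cases hcx : c ≤ x <;> simp [indicator, hcx]
  · refine Measurable.aemeasurable ?_
    exact Measurable.indicator (by fun_prop) (measurableSet_le measurable_snd measurable_fst)

theorem distFun_nonneg (f : ℝ → ℝ) (c : ℝ) : 0 ≤ distFun f c := measureReal_nonneg

/-- Since `ψ f = c f + F`, the right side is the expected virtual cost below `z`. After Tonelli a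
cost `c ≤ z` contributes `c` plus the length of `[c, z]`, which lies in the support because the
support is an interval; the sum is `z`. -/
theorem setLIntegral_virtualCost_Iic {f : ℝ → ℝ} (hf : Measurable f)
    (h : ∫⁻ c, ENNReal.ofReal (f c) = 1) (hI : {c | 0 < f c}.OrdConnected)
    (hnn : ∀ c, 0 < f c → 0 ≤ c) {z : ℝ} (hz : 0 < f z) :
    ENNReal.ofReal (z * distFun f z) =
      (∫⁻ c in {c | 0 < f c},
        (Iic z).indicator (fun c => ENNReal.ofReal (f c) * ENNReal.ofReal c) c)
        + ∫⁻ c in {c | 0 < f c}, (Iic z).indicator 1 c * ENNReal.ofReal (distFun f c) := by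
  have hIm : MeasurableSet {c | 0 < f c} := measurableSet_lt measurable_const hf
  have hcf : Measurable ((Iic z).indicator fun c => ENNReal.ofReal (f c) * ENNReal.ofReal c) :=
    (hf.ennreal_ofReal.mul ENNReal.measurable_ofReal).indicator measurableSet_Iic
  rw [setLIntegral_mul_distFun hf h (measurable_one.indicator measurableSet_Iic),
    ← lintegral_add_left hcf,
    ENNReal.ofReal_mul (hnn z hz), ofReal_distFun h, ← lintegral_const_mul _ hf.ennreal_ofReal,
    ← lintegral_indicator measurableSet_Iic, ← lintegral_indicator hIm]
  refine lintegral_congr fun c => ?_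
  by_cases hc : 0 < f c
  · rw [indicator_of_mem (a := c) (s := {c | 0 < f c}) hc, lintegral_indicator_one measurableSet_Iic,
      Measure.restrict_apply measurableSet_Iic]
    by_cases hcz : c ≤ z
    · have : Iic z ∩ ({c | 0 < f c} ∩ Ici c) = Icc c z := by
        ext x
        constructor
        · rintro ⟨h1, h2, h3⟩; exact ⟨h3, h1⟩
        · rintro ⟨h1, h2⟩; exact ⟨h2, hI.out hc hz ⟨h1, h2⟩, h1⟩
      rw [this, Real.volume_Icc, indicator_of_mem (show c ∈ Iic z from hcz),
        indicator_of_mem (show c ∈ Iic z from hcz), ← mul_add,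
        ← ENNReal.ofReal_add (hnn c hc) (sub_nonneg.2 hcz), mul_comm]
      congr 2; ring
    · have : Iic z ∩ ({c | 0 < f c} ∩ Ici c) = ∅ := by
        ext x
        simp only [mem_inter_iff, mem_Iic, mem_Ici, mem_empty_iff_false, iff_false]
        rintro ⟨h1, h2, h3⟩; exact hcz (h3.trans h1)
      simp [this, indicator, hcz]
  · simp [indicator, hc, ENNReal.ofReal_of_nonpos (not_lt.1 hc)]

/-- The minimal expected payment of a regular incentive compatible and individually rational
mechanism is bounded below by every tangent of the virtual cost function. -/
theorem tangent_le_integral_payment {f : ℝ → ℝ} (hf : Measurable f)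
    (h : ∫⁻ c, ENNReal.ofReal (f c) = 1) (hI : {c | 0 < f c}.OrdConnected)
    (hnn : ∀ c, 0 < f c → 0 ≤ c) (hψ : StrictMonoOn (virtualCost f) {c | 0 < f c})
    {a p : ℝ → ℝ} (ha : Measurable a) (ha0 : ∀ c, 0 ≤ a c) (ha1 : ∀ c, a c ≤ 1)
    (hp : Measurable p) (hpi : Integrable p (densityLaw f))
    (hIC : ∀ C, 0 < f C → ∀ c, p c - a c * C ≤ p C - a C * C)
    (hIR : ∀ C, 0 < f C → 0 ≤ p C - a C * C) {z : ℝ} (hz : 0 < f z) :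
    virtualCost f z * (∫ c, a c ∂densityLaw f - distFun f z) + z * distFun f z
      ≤ ∫ c, p c ∂densityLaw f := by
  have := isProbabilityMeasure_densityLaw h
  have hIm : MeasurableSet {c | 0 < f c} := measurableSet_lt measurable_const hf
  have hsupp : ∀ᵐ c ∂densityLaw f, 0 < f c := by
    rw [densityLaw, ae_withDensity_iff hf.ennreal_ofReal]
    refine ae_of_all _ fun c hc => ?_
    simpa using hc
  have hFm : Measurable (distFun f) :=
    Monotone.measurable fun x y hxy => measureReal_mono (Iic_subset_Iic.2 hxy)
  have hone : Measurable ((Iic z).indicator (1 : ℝ → ENNReal)) :=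
    measurable_one.indicator measurableSet_Iic
  have hcf : Measurable ((Iic z).indicator fun c => ENNReal.ofReal (f c) * ENNReal.ofReal c) :=
    (hf.ennreal_ofReal.mul ENNReal.measurable_ofReal).indicator measurableSet_Iic
  have hψ0 : ∀ c, 0 < f c → 0 ≤ virtualCost f c := fun c hc =>
    add_nonneg (hnn c hc) (div_nonneg (distFun_nonneg f c) hc.le)
  have hψf : ∀ c, 0 < f c → virtualCost f c * f c = f c * c + distFun f c := fun c hc => by
    rw [virtualCost, add_mul, div_mul_cancel₀ _ hc.ne', mul_comm c]
  have hai : Integrable a (densityLaw f) :=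
    Integrable.of_bound ha.aestronglyMeasurable 1
      (ae_of_all _ fun c => by rw [Real.norm_eq_abs, abs_of_nonneg (ha0 c)]; exact ha1 c)
  have hp0 : ∀ C, 0 < f C → 0 ≤ p C := fun C hC => by
    have := hIR C hC; have := mul_nonneg (ha0 C) (hnn C hC); linarith
  -- the expected payment dominates the expected virtual cost
  have hlow : ∫⁻ c in {c | 0 < f c}, (ENNReal.ofReal (f c) * ENNReal.ofReal (a c * c)
      + ENNReal.ofReal (a c) * ENNReal.ofReal (distFun f c)) ≤
      ENNReal.ofReal (∫ c, p c ∂densityLaw f) := by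
    rw [ofReal_integral_eq_lintegral_ofReal hpi (hsupp.mono fun c hc => hp0 c hc),
      lintegral_densityLaw hf hp.ennreal_ofReal,
      lintegral_add_right _ (by fun_prop),
      setLIntegral_mul_distFun hf h ha.ennreal_ofReal,
      ← lintegral_add_left (by fun_prop)]
    refine setLIntegral_mono' hIm fun c hc => ?_
    rw [← mul_add]
    gcongr
    have hsub := setLIntegral_le_of_subgradient hI (U := fun c => p c - a c * c) (a := a)
      (fun c hc C hC => by have := hIC c hc C; linarith) (fun c _ => ha0 c)
      (fun c _ => ha1 c) hIR hc
    refine (add_le_add_right hsub _).trans ?_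
    rw [← ENNReal.ofReal_add (mul_nonneg (ha0 c) (hnn c hc)) (hIR c hc)]
    exact ENNReal.ofReal_le_ofReal (by linarith)
  have hFz : ENNReal.ofReal (distFun f z) =
      ∫⁻ c in {c | 0 < f c}, ENNReal.ofReal (f c) * (Iic z).indicator 1 c := by
    rw [← lintegral_densityLaw hf (measurable_one.indicator measurableSet_Iic),
      lintegral_indicator_one measurableSet_Iic, distFun, ofReal_measureReal]
  have hEa : ENNReal.ofReal (∫ c, a c ∂densityLaw f) =
      ∫⁻ c in {c | 0 < f c}, ENNReal.ofReal (f c) * ENNReal.ofReal (a c) := by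
    rw [← lintegral_densityLaw hf ha.ennreal_ofReal,
      ofReal_integral_eq_lintegral_ofReal hai (ae_of_all _ ha0)]
  have hEa0 : 0 ≤ ∫ c, a c ∂densityLaw f := integral_nonneg ha0
  have hEp0 : 0 ≤ ∫ c, p c ∂densityLaw f :=
    integral_nonneg_of_ae (hsupp.mono fun c hc => hp0 c hc)
  -- This integrates `(a(c) - 1_{c ≤ z}) (ψ(c) - ψ(z)) f(c) ≥ 0`, with terms arranged so that both
  -- sides are nonnegative and no integrability of `ψ` is needed.
  have main : ENNReal.ofReal (z * distFun f z)
      + ENNReal.ofReal (virtualCost f z * ∫ c, a c ∂densityLaw f) ≤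
      ENNReal.ofReal (∫ c, p c ∂densityLaw f)
        + ENNReal.ofReal (virtualCost f z * distFun f z) := by
    refine le_trans ?_ (add_le_add_left hlow _)
    rw [setLIntegral_virtualCost_Iic hf h hI hnn hz, ENNReal.ofReal_mul (hψ0 z hz),
      ENNReal.ofReal_mul (hψ0 z hz), hFz, hEa,
      ← lintegral_const_mul _ (by fun_prop),
      ← lintegral_const_mul _ (by fun_prop), ← lintegral_add_left hcf,
      ← lintegral_add_right _ (by fun_prop), ← lintegral_add_right _ (by fun_prop)]
    refine setLIntegral_mono' hIm fun c hc => ?_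
    have hc' : 0 < f c := hc
    have hF := distFun_nonneg f c
    have hca := mul_nonneg (ha0 c) (hnn c hc)
    by_cases hcz : c ≤ z
    · have hle : virtualCost f c ≤ virtualCost f z := hψ.monotoneOn hc hz hcz
      simp only [indicator_of_mem (show c ∈ Iic z from hcz), Pi.one_apply, one_mul, mul_one]
      rw [← ENNReal.ofReal_mul hc'.le, ← ENNReal.ofReal_mul hc'.le, ← ENNReal.ofReal_mul hc'.le,
        ← ENNReal.ofReal_mul (hψ0 z hz), ← ENNReal.ofReal_mul (hψ0 z hz),
        ← ENNReal.ofReal_mul (ha0 c),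
        ← ENNReal.ofReal_add (mul_nonneg hc'.le (hnn c hc)) hF,
        ← ENNReal.ofReal_add (add_nonneg (mul_nonneg hc'.le (hnn c hc)) hF)
          (mul_nonneg (hψ0 z hz) (mul_nonneg hc'.le (ha0 c))),
        ← ENNReal.ofReal_add (mul_nonneg hc'.le hca) (mul_nonneg (ha0 c) hF),
        ← ENNReal.ofReal_add (add_nonneg (mul_nonneg hc'.le hca) (mul_nonneg (ha0 c) hF))
          (mul_nonneg (hψ0 z hz) hc'.le)]
      refine ENNReal.ofReal_le_ofReal ?_
      have e := hψf c hc
      have := mul_nonneg (mul_nonneg (sub_nonneg.2 (ha1 c)) (sub_nonneg.2 hle)) hc'.le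
      linear_combination this - (1 - a c) * e
    · have hle : virtualCost f z ≤ virtualCost f c := hψ.monotoneOn hz hc (not_le.1 hcz).le
      simp only [indicator_of_notMem (show c ∉ Iic z from hcz), zero_mul, mul_zero, add_zero,
        zero_add]
      rw [← ENNReal.ofReal_mul hc'.le, ← ENNReal.ofReal_mul hc'.le,
        ← ENNReal.ofReal_mul (hψ0 z hz), ← ENNReal.ofReal_mul (ha0 c),
        ← ENNReal.ofReal_add (mul_nonneg hc'.le hca) (mul_nonneg (ha0 c) hF)]
      refine ENNReal.ofReal_le_ofReal ?_
      have e := hψf c hc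
      have := mul_nonneg (mul_nonneg (ha0 c) (sub_nonneg.2 hle)) hc'.le
      linear_combination this + a c * e
  have hFz0 := distFun_nonneg f z
  have hz0 := hnn z hz
  rw [← ENNReal.ofReal_add (mul_nonneg hz0 hFz0) (mul_nonneg (hψ0 z hz) hEa0),
    ← ENNReal.ofReal_add hEp0 (mul_nonneg (hψ0 z hz) hFz0),
    ENNReal.ofReal_le_ofReal_iff (add_nonneg hEp0 (mul_nonneg (hψ0 z hz) hFz0))] at main
  linarith

/-! ### Quantiles -/

theorem continuous_distFun {f : ℝ → ℝ} (hf : Measurable f) (hf0 : ∀ c, 0 ≤ f c)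
    (h : ∫⁻ c, ENNReal.ofReal (f c) = 1) : Continuous (distFun f) := by
  have hint_f : Integrable f :=
    ⟨hf.aestronglyMeasurable, by
      rw [hasFiniteIntegral_iff_ofReal (ae_of_all _ hf0), h]; exact ENNReal.one_lt_top⟩
  have e : distFun f = fun c => distFun f 0 + ∫ x in (0 : ℝ)..c, f x := by
    have e0 : ∀ c, distFun f c = ∫ x in Iic c, f x := fun c => by
      rw [← ENNReal.toReal_ofReal (distFun_nonneg f c), ofReal_distFun h,
        integral_eq_lintegral_of_nonneg_ae (ae_of_all _ hf0) hf.aestronglyMeasurable]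
    funext c
    rw [e0, e0, ← intervalIntegral.integral_Iic_sub_Iic hint_f.integrableOn hint_f.integrableOn]
    ring
  rw [e]
  exact continuous_const.add (intervalIntegral.continuous_primitive
    (fun a b => hint_f.intervalIntegrable) 0)

/-- Intermediate values: costs are nonnegative, so `F(-1) = 0`, and `F` is continuous with limit
`1`. -/
theorem mem_range_distFun {f : ℝ → ℝ} (hf : Measurable f) (hf0 : ∀ c, 0 ≤ f c)
    (h : ∫⁻ c, ENNReal.ofReal (f c) = 1) (hnn : ∀ c, 0 < f c → 0 ≤ c) {u : ℝ} (hu0 : 0 ≤ u)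
    (hu1 : u < 1) : u ∈ range (distFun f) := by
  have := isProbabilityMeasure_densityLaw h
  have h1 : distFun f (-1) = 0 := by
    rw [← ENNReal.toReal_ofReal (distFun_nonneg f (-1)), ofReal_distFun h,
      setLIntegral_congr_fun measurableSet_Iic (g := fun _ => 0), lintegral_zero,
      ENNReal.toReal_zero]
    intro c hc
    simp only [ENNReal.ofReal_eq_zero]
    by_contra! hc'
    have := hnn c hc'
    have := mem_Iic.1 hc
    linarith
  have h2 : Tendsto (distFun f) atTop (nhds 1) := by
    refine (tendsto_cdf_atTop (densityLaw f)).congr fun c => ?_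
    rw [cdf_eq_real]; rfl
  obtain ⟨c, hc⟩ := (h2.eventually_const_lt hu1).exists
  exact mem_range_of_exists_le_of_exists_ge (continuous_distFun hf hf0 h) ⟨-1, h1 ▸ hu0⟩
    ⟨c, hc.le⟩

/-- For `0 < u < 1` the set defining the quantile is nonempty, bounded below and, by continuity of
`F`, closed, so its infimum is attained. -/
theorem distFun_invDistFun {f : ℝ → ℝ} (hf : Measurable f) (hf0 : ∀ c, 0 ≤ f c)
    (h : ∫⁻ c, ENNReal.ofReal (f c) = 1) (hnn : ∀ c, 0 < f c → 0 ≤ c) {u : ℝ} (hu0 : 0 < u)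
    (hu1 : u < 1) : distFun f (invDistFun f u) = u := by
  have := isProbabilityMeasure_densityLaw h
  have hmono : Monotone (distFun f) := fun x y hxy => measureReal_mono (Iic_subset_Iic.2 hxy)
  obtain ⟨w, hw⟩ := mem_range_distFun hf hf0 h hnn hu0.le hu1
  obtain ⟨v, hv⟩ := mem_range_distFun hf hf0 h hnn le_rfl zero_lt_one
  have hbdd : BddBelow {c : ℝ | u ≤ distFun f c} := by
    refine ⟨v, fun c hc => ?_⟩
    by_contra! hlt
    have h1 := hmono hlt.le
    have h2 : u ≤ distFun f c := hc
    linarith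
  have hmem : invDistFun f u ∈ {c : ℝ | u ≤ distFun f c} :=
    (isClosed_le continuous_const (continuous_distFun hf hf0 h)).csInf_mem ⟨w, hw.ge⟩ hbdd
  exact le_antisymm ((hmono (csInf_le hbdd hw.ge)).trans_eq hw) hmem

/-- There is mass on both sides of such a point, and the support is an interval. Thus interior
quantiles are admissible cutoffs in the payment bound. -/
theorem pos_of_distFun_mem_Ioo {f : ℝ → ℝ}
    (h : ∫⁻ c, ENNReal.ofReal (f c) = 1) (hI : {c | 0 < f c}.OrdConnected) {z : ℝ}
    (hz : distFun f z ∈ Ioo (0 : ℝ) 1) : 0 < f z := by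
  have hlow : ∃ x ≤ z, 0 < f x := by
    by_contra! hcon
    refine hz.1.ne' ?_
    rw [← ENNReal.toReal_ofReal (distFun_nonneg f z), ofReal_distFun h,
      setLIntegral_congr_fun measurableSet_Iic (g := fun _ => 0), lintegral_zero,
      ENNReal.toReal_zero]
    intro c hc
    simpa using hcon c hc
  have hup : ∃ x ≥ z, 0 < f x := by
    by_contra! hcon
    refine hz.2.ne ?_
    rw [← ENNReal.toReal_ofReal (distFun_nonneg f z), ofReal_distFun h,
      ← lintegral_indicator measurableSet_Iic, ← ENNReal.toReal_one, ← h]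
    congr 1
    refine lintegral_congr fun c => ?_
    by_cases hc : c ≤ z
    · simp [indicator, hc]
    · simpa [indicator, hc] using (ENNReal.ofReal_of_nonpos (hcon c (not_le.1 hc).le))
  obtain ⟨x, hx, hfx⟩ := hlow
  obtain ⟨y, hy, hfy⟩ := hup
  exact hI.out hfx hfy ⟨hx, hy⟩

/-! ### Resampling a coordinate of a product measure -/

section Resampling

variable {ι : Type*} [Fintype ι] [DecidableEq ι] {α : ι → Type*} [∀ i, MeasurableSpace (α i)]

/-- Redrawing one coordinate independently does not change a product law. Consequently, averaging an
interim quantity over the carrier's own cost gives the ex ante expectation. -/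
theorem measurePreserving_update (μ : ∀ i, Measure (α i)) [∀ i, IsProbabilityMeasure (μ i)]
    (k : ι) :
    MeasurePreserving (fun q : α k × (∀ i, α i) => Function.update q.2 k q.1)
      ((μ k).prod (Measure.pi μ)) (Measure.pi μ) := by
  have hm : Measurable (fun q : α k × (∀ i, α i) => Function.update q.2 k q.1) := by
    refine measurable_pi_lambda _ fun i => ?_
    by_cases hi : i = k
    · subst hi; simpa using measurable_fst
    · simp only [Function.update_of_ne hi]; fun_prop
  refine ⟨hm, (Measure.pi_eq fun s hs => ?_).symm⟩
  have hpre : (fun q : α k × (∀ i, α i) => Function.update q.2 k q.1) ⁻¹' univ.pi s =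
      s k ×ˢ univ.pi (Function.update s k univ) := by
    ext q
    simp only [mem_preimage, mem_univ_pi, mem_prod]
    constructor
    · refine fun hq => ⟨by simpa using hq k, fun i => ?_⟩
      by_cases hi : i = k
      · subst hi; simp
      · simpa [Function.update_of_ne hi] using hq i
    · rintro ⟨h1, h2⟩ i
      by_cases hi : i = k
      · subst hi; simpa using h1
      · simpa [Function.update_of_ne hi] using h2 i
  rw [Measure.map_apply hm (MeasurableSet.univ_pi hs), hpre, Measure.prod_prod, Measure.pi_pi,
    ← Finset.mul_prod_erase _ _ (Finset.mem_univ k),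
    ← Finset.mul_prod_erase _ _ (Finset.mem_univ k)]
  simp only [Function.update_self, measure_univ, one_mul]
  congr 1
  refine Finset.prod_congr rfl fun i hi => ?_
  rw [Function.update_of_ne (Finset.ne_of_mem_erase hi)]

variable (μ : ∀ i, Measure (α i)) [∀ i, IsProbabilityMeasure (μ i)]

theorem integral_integral_update {g : (∀ i, α i) → ℝ} (hg : Integrable g (Measure.pi μ)) (k : ι) :
    ∫ c, ∫ C, g (Function.update C k c) ∂Measure.pi μ ∂μ k = ∫ C, g C ∂Measure.pi μ := by
  have hmp := measurePreserving_update μ k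
  rw [← hmp.map_eq] at hg
  rw [← hmp.map_eq, integral_map hmp.measurable.aemeasurable hg.1, hmp.map_eq,
    integral_prod (fun q : α k × (∀ i, α i) => g (Function.update q.2 k q.1))
      ((integrable_map_measure hg.1 hmp.measurable.aemeasurable).1 hg)]

theorem integrable_integral_update {g : (∀ i, α i) → ℝ} (hg : Integrable g (Measure.pi μ))
    (k : ι) : Integrable (fun c => ∫ C, g (Function.update C k c) ∂Measure.pi μ) (μ k) := by
  have hmp := measurePreserving_update μ k
  have : Integrable (g ∘ fun q : α k × (∀ i, α i) => Function.update q.2 k q.1)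
      ((μ k).prod (Measure.pi μ)) := hmp.integrable_comp_of_integrable hg
  exact this.integral_prod_left

theorem measurable_integral_update {g : (∀ i, α i) → ℝ} (hg : Measurable g) (k : ι) :
    Measurable (fun c => ∫ C, g (Function.update C k c) ∂Measure.pi μ) := by
  have h : Measurable (fun q : α k × (∀ i, α i) => g (Function.update q.2 k q.1)) :=
    hg.comp (measurePreserving_update μ k).measurable
  exact (h.stronglyMeasurable.integral_prod_right').measurable

end Resampling

/-! ### Lower bound on the expected payments -/

namespace Market

variable {N : Type*} {E : Finset (N × N)}

theorem measurable_allocProb (π : Policy E) (x : State E) (k : Carrier x) :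
    Measurable (allocProb π x k) :=
  ((π.lottery x).measurable_coe (MeasurableSet.of_discrete)).ennreal_toReal

theorem allocProb_nonneg (π : Policy E) (x : State E) (k : Carrier x) (c : Bids x) :
    0 ≤ allocProb π x k c := measureReal_nonneg

theorem shipped_eq_sum {x : State E} (W : Outcome x) (l : Lane E) :
    (shipped W l : ℝ) =
      ∑ s : Fin (x.1 l), {W : Outcome x | W ⟨l, s⟩ = true}.indicator (fun _ => (1 : ℝ)) W := by
  rw [shipped, Finset.card_filter]
  push_cast
  refine Finset.sum_congr rfl fun s _ => ?_
  simp [indicator]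

variable [DecidableEq N] (M : Market E) {π : Policy E}

instance (l : Lane E) : IsProbabilityMeasure (M.costLaw l) :=
  isProbabilityMeasure_densityLaw (M.density_lintegral l)

instance (x : State E) : IsProbabilityMeasure (M.profileLaw x) := by
  unfold profileLaw; infer_instance

variable {M}

theorem IsPolicy.isProbabilityMeasure_outcomeLaw (hπ : M.IsPolicy π) (x : State E) :
    IsProbabilityMeasure (M.outcomeLaw π x) := by
  have := hπ.lottery_markov x
  unfold outcomeLaw; infer_instance

theorem IsPolicy.allocProb_le_one (hπ : M.IsPolicy π) (x : State E) (k : Carrier x) (c : Bids x) :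
    allocProb π x k c ≤ 1 := by
  have := hπ.lottery_markov x
  exact measureReal_le_one

theorem IsPolicy.integrable_allocProb (hπ : M.IsPolicy π) (x : State E) (k : Carrier x)
    (μ : Measure (Bids x)) [IsFiniteMeasure μ] : Integrable (allocProb π x k) μ :=
  Integrable.of_bound (measurable_allocProb π x k).aestronglyMeasurable 1
    (ae_of_all _ fun c => by
      rw [Real.norm_eq_abs, abs_of_nonneg (allocProb_nonneg π x k c)]
      exact hπ.allocProb_le_one x k c)

/-- By independence, each carrier faces a one-dimensional mechanism given by the interim allocation
and payment, to which the single-carrier bound applies. -/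
theorem IsPolicy.tangent_le_integral_payment (hπ : M.IsPolicy π) (hIC : M.IsIC π)
    (hIR : M.IsIR π) (x : State E) (k : Carrier x) {z : ℝ} (hz : 0 < M.density k.1 z) :
    virtualCost (M.density k.1) z * (∫ C, allocProb π x k C ∂M.profileLaw x - M.F k.1 z)
      + z * M.F k.1 z ≤ ∫ C, π.payment x k C ∂M.profileLaw x := by
  have hA := hπ.integrable_allocProb x k (M.profileLaw x)
  have hP := hπ.payment_integrable x k
  have e1 := integral_integral_update (fun k : Carrier x => M.costLaw k.1) hA k
  have e2 := integral_integral_update (fun k : Carrier x => M.costLaw k.1) hP k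
  unfold profileLaw
  rw [← e1, ← e2]
  have hA0 : ∀ c, 0 ≤ M.interimAlloc π x k c := fun c =>
    integral_nonneg fun C => allocProb_nonneg π x k _
  have hA1 : ∀ c, M.interimAlloc π x k c ≤ 1 := fun c => by
    unfold interimAlloc
    refine (integral_mono_of_nonneg (ae_of_all _ fun C => allocProb_nonneg π x k _)
      (integrable_const (1 : ℝ)) (ae_of_all _ fun C => hπ.allocProb_le_one x k _)).trans ?_
    simp
  exact Freight.tangent_le_integral_payment (M.density_measurable k.1) (M.density_lintegral k.1)
    (M.density_interval k.1) (M.cost_nonneg k.1) (M.virtualCost_strictMono k.1)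
    (measurable_integral_update _ (measurable_allocProb π x k) k) hA0 hA1
    (measurable_integral_update _ (hπ.payment_measurable x k) k)
    (integrable_integral_update _ hP k) (hIC x k) (hIR x k) hz

theorem IsPolicy.integral_payment_nonneg (hπ : M.IsPolicy π)
    (hIR : M.IsIR π) (x : State E) (k : Carrier x) :
    0 ≤ ∫ C, π.payment x k C ∂M.profileLaw x := by
  have e2 := integral_integral_update (fun k : Carrier x => M.costLaw k.1)
    (hπ.payment_integrable x k) k
  unfold profileLaw
  rw [← e2]
  refine integral_nonneg_of_ae ?_
  have hsupp : ∀ᵐ c ∂M.costLaw k.1, 0 < M.density k.1 c := by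
    rw [costLaw, densityLaw, ae_withDensity_iff (M.density_measurable k.1).ennreal_ofReal]
    refine ae_of_all _ fun c hc => ?_
    simpa using hc
  filter_upwards [hsupp] with c hc
  have h1 := hIR x k c hc
  have h2 : 0 ≤ M.interimAlloc π x k c := integral_nonneg fun C => allocProb_nonneg π x k _
  have h3 := mul_nonneg h2 (M.cost_nonneg k.1 c hc)
  have h4 : (0 : ℝ) ≤ M.interimPayment π x k c := by linarith
  exact h4

theorem IsPolicy.meanShipped_eq (hπ : M.IsPolicy π) (x : State E) (l : Lane E) :
    M.meanShipped π x l = ∑ s : Fin (x.1 l), ∫ C, allocProb π x ⟨l, s⟩ C ∂M.profileLaw x := by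
  have := hπ.lottery_markov x
  have := hπ.isProbabilityMeasure_outcomeLaw x
  unfold meanShipped
  simp_rw [shipped_eq_sum]
  rw [integral_finsetSum _ fun s _ =>
    (integrable_const (1 : ℝ)).indicator (MeasurableSet.of_discrete)]
  refine Finset.sum_congr rfl fun s _ => ?_
  rw [integral_indicator_const _ (MeasurableSet.of_discrete), smul_eq_mul, mul_one]
  unfold allocProb Measure.real outcomeLaw
  rw [Measure.bind_apply (MeasurableSet.of_discrete) (π.lottery x).measurable.aemeasurable,
    integral_toReal ((π.lottery x).measurable_coe (MeasurableSet.of_discrete)).aemeasurable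
      (ae_of_all _ fun C => measure_lt_top _ _)]

theorem IsPolicy.meanPayment_eq (hπ : M.IsPolicy π) (x : State E) (l : Lane E) :
    M.meanPayment π x l = ∑ s : Fin (x.1 l), ∫ C, π.payment x ⟨l, s⟩ C ∂M.profileLaw x :=
  integral_finsetSum _ fun s _ => hπ.payment_integrable x ⟨l, s⟩

/-- For fixed `z` the bound is linear in mean shipments and supply with coefficients independent of
the state, so it can be averaged over states. -/
theorem IsPolicy.tangent_le_meanPayment (hπ : M.IsPolicy π) (hIC : M.IsIC π)
    (hIR : M.IsIR π) (x : State E) (l : Lane E) {z : ℝ} (hz : 0 < M.density l z) :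
    virtualCost (M.density l) z * M.meanShipped π x l +
      (z - virtualCost (M.density l) z) * M.F l z * x.1 l ≤ M.meanPayment π x l := by
  rw [hπ.meanPayment_eq, hπ.meanShipped_eq]
  have h := Finset.sum_le_sum fun (s : Fin (x.1 l)) (_ : s ∈ Finset.univ) =>
    hπ.tangent_le_integral_payment hIC hIR x ⟨l, s⟩ hz
  refine le_trans (le_of_eq ?_) h
  simp only [Finset.sum_add_distrib, ← Finset.mul_sum, Finset.sum_sub_distrib, Finset.sum_const,
    Finset.card_univ, Fintype.card_fin, nsmul_eq_mul]
  ring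

theorem IsPolicy.meanPayment_nonneg (hπ : M.IsPolicy π) (hIR : M.IsIR π) (x : State E)
    (l : Lane E) : 0 ≤ M.meanPayment π x l := by
  rw [hπ.meanPayment_eq]
  exact Finset.sum_nonneg fun s _ => hπ.integral_payment_nonneg hIR x ⟨l, s⟩

theorem meanShipped_nonneg (π : Policy E) (x : State E) (l : Lane E) :
    0 ≤ M.meanShipped π x l := integral_nonneg fun _ => Nat.cast_nonneg _

theorem IsPolicy.meanShipped_le_supply (hπ : M.IsPolicy π) (x : State E) (l : Lane E) :
    M.meanShipped π x l ≤ x.1 l := by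
  have := hπ.isProbabilityMeasure_outcomeLaw x
  refine (integral_mono_of_nonneg (ae_of_all _ fun _ => Nat.cast_nonneg _)
    (integrable_const (x.1 l : ℝ)) (ae_of_all _ fun W => ?_)).trans (by simp)
  have : shipped W l ≤ x.1 l := (Finset.card_filter_le _ _).trans (by simp)
  exact Nat.cast_le.2 this

theorem IsPolicy.meanShipped_le_loads (hπ : M.IsPolicy π) (x : State E) (l : Lane E) :
    M.meanShipped π x l ≤ x.2 l := by
  have := hπ.isProbabilityMeasure_outcomeLaw x
  refine (integral_mono_of_nonneg (ae_of_all _ fun _ => Nat.cast_nonneg _)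
    (integrable_const (x.2 l : ℝ)) ?_).trans (by simp)
  have h : ∀ᵐ W ∂M.outcomeLaw π x, shipped W l ≤ x.2 l := by
    rw [ae_iff, outcomeLaw, Measure.bind_apply (MeasurableSet.of_discrete)
      (π.lottery x).measurable.aemeasurable]
    refine (lintegral_congr fun C => ?_).trans lintegral_zero
    exact ae_iff.1 (hπ.shipped_le x C l)
  filter_upwards [h] with W hW
  exact Nat.cast_le.2 hW

end Market

/-! ### First moments of the transition law -/

theorem lintegral_natCast_poissonMeasure (r : NNReal) :
    ∫⁻ n, (n : ENNReal) ∂poissonMeasure r = r := by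
  have h1 : ∑' n : ℕ, poissonMeasure r {n} = 1 := by
    have := lintegral_countable' (μ := poissonMeasure r) (fun _ => 1)
    simpa using this.symm
  rw [lintegral_countable', tsum_eq_zero_add' ENNReal.summable]
  have h2 : ∀ n : ℕ, ((n + 1 : ℕ) : ENNReal) * poissonMeasure r {n + 1} =
      r * poissonMeasure r {n} := by
    intro n
    rw [poissonMeasure_singleton, poissonMeasure_singleton, ← ENNReal.ofReal_natCast,
      ← ENNReal.ofReal_coe_nnreal, ← ENNReal.ofReal_mul (by positivity),
      ← ENNReal.ofReal_mul (by positivity), Nat.factorial_succ]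
    congr 1
    push_cast
    field_simp
    ring
  simp_rw [h2]
  rw [ENNReal.tsum_mul_left, h1]
  simp

namespace Market

variable {N : Type*} {E : Finset (N × N)}

instance (rate : Lane E → ℝ) : IsProbabilityMeasure (poissonLaw rate) := by
  unfold poissonLaw; infer_instance

theorem lintegral_poissonLaw (rate : Lane E → ℝ) (l : Lane E) :
    ∫⁻ m, (m l : ENNReal) ∂poissonLaw rate = ENNReal.ofReal (rate l) := by
  have hmp := measurePreserving_eval (fun l : Lane E => poissonMeasure (rate l).toNNReal) l
  have := hmp.lintegral_comp (f := fun n : ℕ => (n : ENNReal)) .of_discrete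
  exact this.trans (lintegral_natCast_poissonMeasure _)

variable [DecidableEq N] (M : Market E) {π : Policy E}

instance (j : N) : IsProbabilityMeasure (M.moveLaw j) := by
  refine ⟨?_⟩
  have h0 : ∀ l : Lane E, 0 ≤ if l.1.1 = j then M.stay l else 0 := fun l => by
    split_ifs
    · exact M.stay_nonneg l
    · exact le_rfl
  have e : ∀ l : Lane E, (if l.1.1 = j then ENNReal.ofReal (M.stay l) else 0) =
      ENNReal.ofReal (if l.1.1 = j then M.stay l else 0) := fun l => by
    split_ifs <;> simp
  simp only [moveLaw, Measure.add_apply, Measure.smul_apply, Measure.finsetSum_apply, measure_univ,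
    smul_eq_mul, mul_one, e]
  rw [← ENNReal.ofReal_sum_of_nonneg fun l _ => h0 l,
    ← ENNReal.ofReal_add (sub_nonneg.2 (M.stay_sum_le j)) (Finset.sum_nonneg fun l _ => h0 l)]
  simp

theorem lintegral_moveLaw (j : N) (l : Lane E) :
    ∫⁻ m, (m l : ENNReal) ∂M.moveLaw j =
      if l.1.1 = j then ENNReal.ofReal (M.stay l) else 0 := by
  rw [moveLaw, lintegral_add_measure, lintegral_smul_measure, lintegral_finsetSum_measure,
    Finset.sum_eq_single (M := ENNReal) l]
  · rw [lintegral_smul_measure, lintegral_dirac' _ .of_discrete, lintegral_dirac' _ .of_discrete]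
    simp
  · intro k _ hk
    rw [lintegral_smul_measure, lintegral_dirac' _ .of_discrete]
    simp [Pi.single_eq_of_ne hk.symm]
  · simp

instance (Y : Lane E → ℕ) : IsProbabilityMeasure (M.stayLaw Y) :=
  Measure.isProbabilityMeasure_map (Measurable.of_discrete).aemeasurable

theorem lintegral_stayLaw (Y : Lane E → ℕ) (l : Lane E) :
    ∫⁻ m, (m l : ENNReal) ∂M.stayLaw Y =
      ∑ k : Lane E, if k.1.2 = l.1.1 then ENNReal.ofReal (M.stay l) * Y k else 0 := by
  rw [stayLaw, lintegral_map .of_discrete .of_discrete]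
  simp only [Finset.sum_apply, Nat.cast_sum]
  rw [lintegral_finsetSum _ fun _ _ => .of_discrete]
  have h : ∀ k : (Σ l : Lane E, Fin (Y l)),
      ∫⁻ m, ((m k l : ℕ) : ENNReal)
        ∂Measure.pi (fun k : (Σ l : Lane E, Fin (Y l)) => M.moveLaw k.1.1.2) =
      if l.1.1 = k.1.1.2 then ENNReal.ofReal (M.stay l) else 0 := by
    intro k
    have hmp := measurePreserving_eval
      (fun k : (Σ l : Lane E, Fin (Y l)) => M.moveLaw k.1.1.2) k
    have := hmp.lintegral_comp (f := fun m : Lane E → ℕ => (m l : ENNReal)) .of_discrete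
    exact this.trans (M.lintegral_moveLaw _ l)
  simp_rw [h]
  rw [Fintype.sum_sigma]
  refine Finset.sum_congr rfl fun k _ => ?_
  simp only [eq_comm (a := l.1.1)]
  split_ifs
  · simp [mul_comm]
  · simp

/-- The expected number of carriers on lane `l` in the next period when `y` carriers ship. -/
def inflow (y : Lane E → ℝ) (l : Lane E) : ℝ :=
  (∑ k : Lane E, if k.1.2 = l.1.1 then M.stay l * y k else 0) + M.arrival l

variable {M}

theorem IsPolicy.lintegral_shipped (hπ : M.IsPolicy π) (x : State E) (l : Lane E) :
    ∫⁻ W, (shipped W l : ENNReal) ∂M.outcomeLaw π x = ENNReal.ofReal (M.meanShipped π x l) := by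
  have := hπ.isProbabilityMeasure_outcomeLaw x
  rw [meanShipped, ofReal_integral_eq_lintegral_ofReal (.of_finite)
    (ae_of_all _ fun _ => Nat.cast_nonneg _)]
  simp

theorem IsPolicy.isProbabilityMeasure_step (hπ : M.IsPolicy π) (x : State E) :
    IsProbabilityMeasure (M.step π x) := by
  have := hπ.isProbabilityMeasure_outcomeLaw x
  have : IsProbabilityMeasure ((M.outcomeLaw π x).bind fun W => M.stayLaw (shipped W)) :=
    isProbabilityMeasure_bind (Measurable.of_discrete).aemeasurable
      (ae_of_all _ fun W => inferInstance)
  exact Measure.isProbabilityMeasure_map (Measurable.of_discrete).aemeasurable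

theorem IsPolicy.lintegral_supply_step (hπ : M.IsPolicy π) (x : State E) (l : Lane E) :
    ∫⁻ x', (x'.1 l : ENNReal) ∂M.step π x =
      ENNReal.ofReal (M.inflow (M.meanShipped π x) l) := by
  have := hπ.isProbabilityMeasure_outcomeLaw x
  have : IsProbabilityMeasure ((M.outcomeLaw π x).bind fun W => M.stayLaw (shipped W)) :=
    isProbabilityMeasure_bind (Measurable.of_discrete).aemeasurable
      (ae_of_all _ fun W => inferInstance)
  rw [step, lintegral_map .of_discrete .of_discrete]
  simp only [Pi.add_apply, Nat.cast_add]
  rw [lintegral_add_left .of_discrete]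
  have h1 := (measurePreserving_fst
    (μ := (M.outcomeLaw π x).bind fun W => M.stayLaw (shipped W))
    (ν := (poissonLaw M.arrival).prod
      (poissonLaw fun l => M.demand l (π.price x l)))).lintegral_comp
    (f := fun m : Lane E → ℕ => (m l : ENNReal)) .of_discrete
  have h2 := ((measurePreserving_fst (μ := poissonLaw M.arrival)
    (ν := poissonLaw fun l => M.demand l (π.price x l))).comp (measurePreserving_snd
    (μ := (M.outcomeLaw π x).bind fun W => M.stayLaw (shipped W))
    (ν := (poissonLaw M.arrival).prod
      (poissonLaw fun l => M.demand l (π.price x l))))).lintegral_comp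
    (f := fun m : Lane E → ℕ => (m l : ENNReal)) .of_discrete
  refine (congrArg₂ (· + ·) h1 h2).trans ?_
  rw [lintegral_poissonLaw, Measure.lintegral_bind (Measurable.of_discrete).aemeasurable
    (Measurable.of_discrete).aemeasurable]
  simp_rw [lintegral_stayLaw]
  rw [lintegral_finsetSum _ fun _ _ => .of_discrete, inflow,
    ENNReal.ofReal_add _ (M.arrival_pos l).le, ENNReal.ofReal_sum_of_nonneg]
  · congr 1
    refine Finset.sum_congr rfl fun k _ => ?_
    split_ifs
    · rw [lintegral_const_mul _ .of_discrete, hπ.lintegral_shipped,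
        ENNReal.ofReal_mul (M.stay_nonneg l)]
    · simp
  · intro k _
    split_ifs
    · exact mul_nonneg (M.stay_nonneg l) (meanShipped_nonneg π x k)
    · exact le_rfl
  · refine Finset.sum_nonneg fun k _ => ?_
    split_ifs
    · exact mul_nonneg (M.stay_nonneg l) (meanShipped_nonneg π x k)
    · exact le_rfl

theorem IsPolicy.lintegral_loads_step (hπ : M.IsPolicy π) (x : State E) (l : Lane E) :
    ∫⁻ x', (x'.2 l : ENNReal) ∂M.step π x = ENNReal.ofReal (M.demand l (π.price x l)) := by
  have := hπ.isProbabilityMeasure_outcomeLaw x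
  have : IsProbabilityMeasure ((M.outcomeLaw π x).bind fun W => M.stayLaw (shipped W)) :=
    isProbabilityMeasure_bind (Measurable.of_discrete).aemeasurable
      (ae_of_all _ fun W => inferInstance)
  rw [step, lintegral_map .of_discrete .of_discrete]
  have h2 := ((measurePreserving_snd (μ := poissonLaw M.arrival)
    (ν := poissonLaw fun l => M.demand l (π.price x l))).comp (measurePreserving_snd
    (μ := (M.outcomeLaw π x).bind fun W => M.stayLaw (shipped W))
    (ν := (poissonLaw M.arrival).prod
      (poissonLaw fun l => M.demand l (π.price x l))))).lintegral_comp
    (f := fun m : Lane E → ℕ => (m l : ENNReal)) .of_discrete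
  exact h2.trans (lintegral_poissonLaw _ l)

theorem IsPolicy.isProbabilityMeasure_stateLaw (hπ : M.IsPolicy π) (ν : Measure (State E))
    [IsProbabilityMeasure ν] (t : ℕ) : IsProbabilityMeasure (M.stateLaw π ν t) := by
  induction t with
  | zero => assumption
  | succ t ih =>
    exact isProbabilityMeasure_bind (Measurable.of_discrete).aemeasurable
      (ae_of_all _ fun x => hπ.isProbabilityMeasure_step x)

/-- Integrability of the supplies and the loads under a law of the state. -/
structure FiniteMeans (μ : Measure (State E)) : Prop where
  supply : ∀ l, Integrable (fun x : State E => (x.1 l : ℝ)) μ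
  loads : ∀ l, Integrable (fun x : State E => (x.2 l : ℝ)) μ

theorem IsPolicy.integrable_meanShipped (hπ : M.IsPolicy π) {μ : Measure (State E)}
    (hμ : FiniteMeans μ) (l : Lane E) : Integrable (fun x => M.meanShipped π x l) μ := by
  refine (hμ.supply l).mono' (Measurable.of_discrete).aestronglyMeasurable (ae_of_all _ fun x => ?_)
  rw [Real.norm_eq_abs, abs_of_nonneg (meanShipped_nonneg π x l)]
  exact hπ.meanShipped_le_supply x l

theorem IsPolicy.demand_nonneg (hπ : M.IsPolicy π) (x : State E) (l : Lane E) :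
    0 ≤ M.demand l (π.price x l) := M.demand_nonneg l _ (hπ.price_mem x l)

theorem IsPolicy.integrable_demand (hπ : M.IsPolicy π) (μ : Measure (State E))
    [IsFiniteMeasure μ] (l : Lane E) : Integrable (fun x => M.demand l (π.price x l)) μ := by
  obtain ⟨B, hB⟩ := hπ.demand_bounded
  refine Integrable.of_bound (Measurable.of_discrete).aestronglyMeasurable B
    (ae_of_all _ fun x => ?_)
  rw [Real.norm_eq_abs, abs_of_nonneg (hπ.demand_nonneg x l)]
  exact hB x l

theorem inflow_nonneg {y : Lane E → ℝ} (hy : ∀ l, 0 ≤ y l) (l : Lane E) : 0 ≤ M.inflow y l := by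
  refine add_nonneg (Finset.sum_nonneg fun k _ => ?_) (M.arrival_pos l).le
  split_ifs
  · exact mul_nonneg (M.stay_nonneg l) (hy k)
  · exact le_rfl

theorem integrable_inflow_summand {μ : Measure (State E)} {y : State E → Lane E → ℝ}
    (hy : ∀ k, Integrable (fun x => y x k) μ) (k l : Lane E) :
    Integrable (fun x => if k.1.2 = l.1.1 then M.stay l * y x k else 0) μ := by
  split_ifs
  · exact (hy k).const_mul _
  · exact integrable_zero _ _ _

theorem integrable_inflow {μ : Measure (State E)} [IsFiniteMeasure μ] {y : State E → Lane E → ℝ}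
    (hy : ∀ k, Integrable (fun x => y x k) μ) (l : Lane E) :
    Integrable (fun x => M.inflow (y x) l) μ :=
  (integrable_finsetSum _ fun k _ => integrable_inflow_summand hy k l).add (integrable_const _)

theorem integral_inflow {μ : Measure (State E)} [IsProbabilityMeasure μ]
    {y : State E → Lane E → ℝ} (hy : ∀ k, Integrable (fun x => y x k) μ) (l : Lane E) :
    ∫ x, M.inflow (y x) l ∂μ = M.inflow (fun k => ∫ x, y x k ∂μ) l := by
  unfold inflow
  rw [integral_add (integrable_finsetSum _ fun k _ => integrable_inflow_summand hy k l)
    (integrable_const _), integral_finsetSum _ fun k _ => integrable_inflow_summand hy k l]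
  congr 1
  · refine Finset.sum_congr rfl fun k _ => ?_
    split_ifs
    · rw [integral_const_mul]
    · simp
  · simp

/-- Moments of the next state are computed as lower Lebesgue integrals, so one computation yields
both finiteness and the value. -/
theorem integrable_natCast_of_lintegral {α : Type*} [MeasurableSpace α] {μ : Measure α}
    {f : α → ℕ} (hf : Measurable f) {r : ℝ} (h : ∫⁻ x, (f x : ENNReal) ∂μ = ENNReal.ofReal r) :
    Integrable (fun x => (f x : ℝ)) μ := by
  refine ⟨(measurable_from_top.comp hf).aestronglyMeasurable, ?_⟩
  rw [hasFiniteIntegral_iff_ofReal (ae_of_all _ fun _ => Nat.cast_nonneg _)]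
  simp [h]

theorem integral_natCast_of_lintegral {α : Type*} [MeasurableSpace α] {μ : Measure α}
    {f : α → ℕ} (hf : Measurable f) {r : ℝ} (hr : 0 ≤ r)
    (h : ∫⁻ x, (f x : ENNReal) ∂μ = ENNReal.ofReal r) : ∫ x, (f x : ℝ) ∂μ = r := by
  rw [integral_eq_lintegral_of_nonneg_ae (ae_of_all _ fun _ => Nat.cast_nonneg _)
    (measurable_from_top.comp hf).aestronglyMeasurable]
  simp [h, hr]

theorem IsPolicy.lintegral_supply_bind_step (hπ : M.IsPolicy π) {μ : Measure (State E)}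
    [IsProbabilityMeasure μ] (hμ : FiniteMeans μ) (l : Lane E) :
    ∫⁻ x, (x.1 l : ENNReal) ∂μ.bind (M.step π) =
      ENNReal.ofReal (M.inflow (fun k => ∫ x, M.meanShipped π x k ∂μ) l) := by
  rw [Measure.lintegral_bind (Measurable.of_discrete).aemeasurable
    (Measurable.of_discrete).aemeasurable]
  simp_rw [hπ.lintegral_supply_step]
  rw [← integral_inflow (hπ.integrable_meanShipped hμ),
    ofReal_integral_eq_lintegral_ofReal (integrable_inflow (hπ.integrable_meanShipped hμ) l)
      (ae_of_all _ fun x => inflow_nonneg (meanShipped_nonneg π x) l)]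

theorem IsPolicy.lintegral_loads_bind_step (hπ : M.IsPolicy π) (μ : Measure (State E))
    [IsProbabilityMeasure μ] (l : Lane E) :
    ∫⁻ x, (x.2 l : ENNReal) ∂μ.bind (M.step π) =
      ENNReal.ofReal (∫ x, M.demand l (π.price x l) ∂μ) := by
  rw [Measure.lintegral_bind (Measurable.of_discrete).aemeasurable
    (Measurable.of_discrete).aemeasurable]
  simp_rw [hπ.lintegral_loads_step]
  rw [ofReal_integral_eq_lintegral_ofReal (hπ.integrable_demand μ l)
    (ae_of_all _ fun x => hπ.demand_nonneg x l)]

theorem IsPolicy.finiteMeans_stateLaw (hπ : M.IsPolicy π) {ν : Measure (State E)}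
    [IsProbabilityMeasure ν] (hν : FiniteMeans ν) (t : ℕ) : FiniteMeans (M.stateLaw π ν t) := by
  induction t with
  | zero => exact hν
  | succ t ih =>
    have := hπ.isProbabilityMeasure_stateLaw ν t
    exact ⟨fun l => integrable_natCast_of_lintegral (f := fun x : State E => x.1 l) .of_discrete
        (hπ.lintegral_supply_bind_step ih l),
      fun l => integrable_natCast_of_lintegral (f := fun x : State E => x.2 l) .of_discrete
        (hπ.lintegral_loads_bind_step (M.stateLaw π ν t) l)⟩

theorem IsPolicy.integral_supply_succ (hπ : M.IsPolicy π) {ν : Measure (State E)}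
    [IsProbabilityMeasure ν] (hν : FiniteMeans ν) (t : ℕ) (l : Lane E) :
    ∫ x, (x.1 l : ℝ) ∂M.stateLaw π ν (t + 1) =
      M.inflow (fun k => ∫ x, M.meanShipped π x k ∂M.stateLaw π ν t) l := by
  have := hπ.isProbabilityMeasure_stateLaw ν t
  exact integral_natCast_of_lintegral (f := fun x : State E => x.1 l) .of_discrete
    (inflow_nonneg (fun k => integral_nonneg fun x => meanShipped_nonneg π x k) l)
    (hπ.lintegral_supply_bind_step (hπ.finiteMeans_stateLaw hν t) l)

theorem IsPolicy.integral_loads_succ (hπ : M.IsPolicy π) (ν : Measure (State E))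
    [IsProbabilityMeasure ν] (t : ℕ) (l : Lane E) :
    ∫ x, (x.2 l : ℝ) ∂M.stateLaw π ν (t + 1) =
      ∫ x, M.demand l (π.price x l) ∂M.stateLaw π ν t := by
  have := hπ.isProbabilityMeasure_stateLaw ν t
  exact integral_natCast_of_lintegral (f := fun x : State E => x.2 l) .of_discrete
    (integral_nonneg fun x => hπ.demand_nonneg x l)
    (hπ.lintegral_loads_bind_step (M.stateLaw π ν t) l)

end Market

/-! ### Supporting lines of concave functions at a mean -/

theorem exists_supporting_line {D : Set ℝ} {R : ℝ → ℝ} (hR : ConcaveOn ℝ D R) {x : ℝ}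
    (hx : x ∈ interior D) : ∃ m : ℝ, ∀ d ∈ D, R d ≤ R x + m * (d - x) := by
  have hc : ConvexOn ℝ D (-R) := hR.neg
  refine ⟨-derivWithin (-R) (Ioi x) x, fun d hd => ?_⟩
  rcases lt_trichotomy d x with hlt | rfl | hlt
  · have h1 := hc.slope_le_leftDeriv_of_mem_interior hd hx hlt
    have h2 := hc.leftDeriv_le_rightDeriv_of_mem_interior hx
    have h3 := h1.trans h2
    rw [slope_def_field, div_le_iff₀ (sub_pos.2 hlt)] at h3
    simp only [Pi.neg_apply] at h3
    nlinarith
  · simp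
  · have h3 := hc.rightDeriv_le_slope_of_mem_interior hx hd hlt
    rw [slope_def_field, le_div_iff₀ (sub_pos.2 hlt)] at h3
    simp only [Pi.neg_apply] at h3
    nlinarith

/-- Jensen's inequality in a form that keeps the slope. A finite supporting slope may fail to exist
at an endpoint of `D`, but a mean located there forces `X` to be a.e. constant, and slope `0`
serves; hence the a.e. quantifier. -/
theorem exists_supporting_line_integral {α : Type*} [MeasurableSpace α] {μ : Measure α}
    [IsProbabilityMeasure μ] {D : Set ℝ} {R : ℝ → ℝ} (hR : ConcaveOn ℝ D R) {X : α → ℝ}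
    (hX : Integrable X μ) (hD : ∀ x, X x ∈ D) :
    ∫ x, X x ∂μ ∈ D ∧ ∃ m : ℝ, ∀ᵐ x ∂μ,
      R (X x) ≤ R (∫ x, X x ∂μ) + m * (X x - ∫ x, X x ∂μ) := by
  set e := ∫ x, X x ∂μ with he
  obtain ⟨p, hp⟩ := exists_le_integral hX
  obtain ⟨q, hq⟩ := exists_integral_le hX
  have hoc : D.OrdConnected := hR.1.ordConnected
  refine ⟨hoc.out (hD p) (hD q) ⟨hp, hq⟩, ?_⟩
  have hconst : ∫ x, (X x - e) ∂μ = 0 := by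
    rw [integral_sub hX (integrable_const _), integral_const]; simp [he]
  have hsub : Integrable (fun x => X x - e) μ := hX.sub (integrable_const _)
  by_cases h1 : ∀ d ∈ D, e ≤ d
  · have h0 := (integral_eq_zero_iff_of_nonneg (fun x => sub_nonneg.2 (h1 _ (hD x))) hsub).1 hconst
    refine ⟨0, h0.mono fun x hx => ?_⟩
    have : X x = e := sub_eq_zero.1 hx
    rw [this]; simp
  by_cases h2 : ∀ d ∈ D, d ≤ e
  · have hneg : ∫ x, (e - X x) ∂μ = 0 := by
      rw [← neg_eq_zero, ← integral_neg, ← hconst]; simp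
    have h0 := (integral_eq_zero_iff_of_nonneg (fun x => sub_nonneg.2 (h2 _ (hD x)))
      ((integrable_const _).sub hX)).1 hneg
    refine ⟨0, h0.mono fun x hx => ?_⟩
    have : e = X x := sub_eq_zero.1 hx
    rw [← this]; simp
  push Not at h1 h2
  obtain ⟨a, ha, hae⟩ := h1
  obtain ⟨b, hb, heb⟩ := h2
  have hmem_int : e ∈ interior D :=
    mem_interior.2 ⟨Ioo a b, fun y hy => hoc.out ha hb ⟨hy.1.le, hy.2.le⟩, isOpen_Ioo, hae, heb⟩
  obtain ⟨m, hm⟩ := exists_supporting_line hR hmem_int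
  exact ⟨m, ae_of_all _ fun x => hm _ (hD x)⟩

theorem coe_sum_ereal {ι : Type*} (s : Finset ι) (f : ι → ℝ) :
    ((∑ i ∈ s, f i : ℝ) : EReal) = ∑ i ∈ s, (f i : EReal) :=
  map_sum (⟨⟨Real.toEReal, EReal.coe_zero⟩, EReal.coe_add⟩ : ℝ →+ EReal) f s

/-- An integrable majorant makes `E[f⁺]` finite, so the difference is never `∞ - ∞`; `f` itself need
not be integrable. -/
theorem extExpectation_le {α : Type*} [MeasurableSpace α] {μ : Measure α} {f g : α → ℝ}
    (hg : Integrable g μ) (hfg : ∀ᵐ x ∂μ, f x ≤ g x) :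
    Market.extExpectation μ f ≤ ((∫ x, g x ∂μ : ℝ) : EReal) := by
  have h1 : ∫⁻ x, ENNReal.ofReal (g x) ∂μ ≠ ⊤ :=
    ((lintegral_mono fun x => Real.ofReal_le_enorm (g x)).trans_lt hg.2).ne
  have h2 : ∫⁻ x, ENNReal.ofReal (-g x) ∂μ ≠ ⊤ :=
    ((lintegral_mono fun x => (Real.ofReal_le_enorm (-g x)).trans_eq (enorm_neg _)).trans_lt
      hg.2).ne
  rw [integral_eq_lintegral_pos_part_sub_lintegral_neg_part hg, EReal.coe_sub,
    EReal.coe_ennreal_toReal h1, EReal.coe_ennreal_toReal h2]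
  unfold Market.extExpectation
  refine EReal.sub_le_sub ?_ ?_
  · exact EReal.coe_ennreal_le_coe_ennreal_iff.2
      (lintegral_mono_ae (hfg.mono fun x hx => ENNReal.ofReal_le_ofReal hx))
  · exact EReal.coe_ennreal_le_coe_ennreal_iff.2
      (lintegral_mono_ae (hfg.mono fun x hx => ENNReal.ofReal_le_ofReal (neg_le_neg hx)))

/-! ### Averages of laws -/

section AverageLaw

variable {α : Type*} [MeasurableSpace α] (μ : ℕ → Measure α)

/-- The average of the laws `μ 0, …, μ (T - 1)`. -/
def averageLaw (T : ℕ) : Measure α := (T : ENNReal)⁻¹ • ∑ t ∈ Finset.range T, μ t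

theorem isProbabilityMeasure_averageLaw [∀ t, IsProbabilityMeasure (μ t)] {T : ℕ} (hT : T ≠ 0) :
    IsProbabilityMeasure (averageLaw μ T) := by
  refine ⟨?_⟩
  simp only [averageLaw, Measure.smul_apply, Measure.finsetSum_apply, measure_univ,
    Finset.sum_const, Finset.card_range, nsmul_eq_mul, mul_one, smul_eq_mul]
  exact ENNReal.inv_mul_cancel (by exact_mod_cast hT) (ENNReal.natCast_ne_top T)

variable {μ}

/-- Null sets of the average are null for each of its terms, so a supporting line found for the
average is valid in every period. -/
theorem ae_of_ae_averageLaw {T : ℕ} {p : α → Prop} (h : ∀ᵐ x ∂averageLaw μ T, p x) {t : ℕ}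
    (ht : t < T) : ∀ᵐ x ∂μ t, p x := by
  rw [ae_iff] at h ⊢
  simp only [averageLaw, Measure.smul_apply, smul_eq_mul, mul_eq_zero, ENNReal.inv_eq_zero,
    ENNReal.natCast_ne_top, false_or, Measure.finsetSum_apply, Finset.sum_eq_zero_iff] at h
  exact h t (Finset.mem_range.2 ht)

theorem integrable_averageLaw {T : ℕ} (hT : T ≠ 0) {g : α → ℝ} (hg : ∀ t, Integrable g (μ t)) :
    Integrable g (averageLaw μ T) :=
  (integrable_finsetSum_measure.2 fun t _ => hg t).smul_measure
    (ENNReal.inv_ne_top.2 (by exact_mod_cast hT))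

theorem integral_averageLaw {T : ℕ} {g : α → ℝ} (hg : ∀ t, Integrable g (μ t)) :
    ∫ x, g x ∂averageLaw μ T = (∑ t ∈ Finset.range T, ∫ x, g x ∂μ t) / T := by
  rw [averageLaw, integral_smul_measure, integral_finsetSum_measure fun t _ => hg t,
    ENNReal.toReal_inv, ENNReal.toReal_natCast, smul_eq_mul, div_eq_inv_mul]

theorem sum_extExpectation_div_le {T : ℕ} {f g : α → ℝ}
    (hg : ∀ t, Integrable g (μ t)) (hfg : ∀ᵐ x ∂averageLaw μ T, f x ≤ g x) :
    (∑ t ∈ Finset.range T, Market.extExpectation (μ t) f) / ((T : ℝ) : EReal) ≤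
      ((∫ x, g x ∂averageLaw μ T : ℝ) : EReal) := by
  rw [integral_averageLaw hg, EReal.coe_div, coe_sum_ereal]
  refine EReal.div_le_div_right_of_nonneg (by exact_mod_cast Nat.cast_nonneg T) ?_
  exact Finset.sum_le_sum fun t ht => extExpectation_le (hg t)
    (ae_of_ae_averageLaw hfg (Finset.mem_range.1 ht))

end AverageLaw

namespace Market

/-! ### Feasible points near the long-run averages -/

section Shrink

variable {N : Type*} {E : Finset (N × N)}

/-- Shrinking the mean shipments of an approximately feasible point. -/
def shrink (ε δ : ℝ) (y : Lane E → ℝ) (l : Lane E) : ℝ := (1 - ε) * max (y l - δ) 0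

variable {ε δ : ℝ} {y : Lane E → ℝ}

theorem shrink_nonneg (hε1 : ε ≤ 1) (l : Lane E) : 0 ≤ shrink ε δ y l :=
  mul_nonneg (sub_nonneg.2 hε1) (le_max_right _ _)

theorem shrink_le_max (hε0 : 0 ≤ ε) (l : Lane E) : shrink ε δ y l ≤ max (y l - δ) 0 :=
  mul_le_of_le_one_left (le_max_right _ _) (by linarith)

theorem shrink_le (hε1 : ε ≤ 1) (hδ : 0 ≤ δ) (hy : ∀ l, 0 ≤ y l) (l : Lane E) :
    shrink ε δ y l ≤ (1 - ε) * y l :=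
  mul_le_mul_of_nonneg_left (max_le (by linarith) (hy l)) (sub_nonneg.2 hε1)

theorem le_shrink (hε1 : ε ≤ 1) (l : Lane E) : (1 - ε) * (y l - δ) ≤ shrink ε δ y l :=
  mul_le_mul_of_nonneg_left (le_max_left _ _) (sub_nonneg.2 hε1)

end Shrink

variable {N : Type*} [DecidableEq N] {E : Finset (N × N)} {M : Market E} {π : Policy E}

theorem inflow_mono {y y' : Lane E → ℝ} (h : ∀ l, y l ≤ y' l) (l : Lane E) :
    M.inflow y l ≤ M.inflow y' l := by
  refine add_le_add_left (Finset.sum_le_sum fun k _ => ?_) _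
  split_ifs
  · exact mul_le_mul_of_nonneg_left (h k) (M.stay_nonneg l)
  · exact le_rfl

theorem inflow_mul_sub (y : Lane E → ℝ) (θ δ : ℝ) (l : Lane E) :
    M.inflow (fun k => θ * (y k - δ)) l =
      θ * (M.inflow y l - δ * (M.inflow 1 l - M.arrival l)) + (1 - θ) * M.arrival l := by
  have h : ∀ k : Lane E, (if k.1.2 = l.1.1 then M.stay l * (θ * (y k - δ)) else 0) =
      θ * (if k.1.2 = l.1.1 then M.stay l * y k else 0) -
        θ * δ * (if k.1.2 = l.1.1 then M.stay l * (1 : Lane E → ℝ) k else 0) := fun k => by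
    split_ifs
    · simp only [Pi.one_apply]; ring
    · simp
  simp only [inflow, h, Finset.sum_sub_distrib, ← Finset.mul_sum]
  ring

theorem arrival_le_inflow {y : Lane E → ℝ} (hy : ∀ l, 0 ≤ y l) (l : Lane E) :
    M.arrival l ≤ M.inflow y l := by
  refine le_add_of_nonneg_left (Finset.sum_nonneg fun k _ => ?_)
  split_ifs
  · exact mul_nonneg (M.stay_nonneg l) (hy k)
  · exact le_rfl

section FeasiblePoint

variable {ε δ : ℝ} {y s d : Lane E → ℝ}

/-- Scaling shipments by `1 - ε` leaves the exogenous arrivals unscaled. The surplus `ε * M.arrival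
l` pays for the supply error `δ` and for the inflow lost by subtracting `δ` from each shipment. -/
theorem mul_supply_lt_inflow_shrink (hε0 : 0 ≤ ε) (hε1 : ε ≤ 1) (hδ : 0 ≤ δ) {l : Lane E}
    (hs : s l ≤ M.inflow y l + δ) (h : δ * (1 + M.inflow 1 l) < ε * M.arrival l) :
    (1 - ε) * s l < M.inflow (shrink ε δ y) l := by
  refine lt_of_lt_of_le ?_ (inflow_mono (fun k => le_shrink hε1 k) l)
  rw [inflow_mul_sub]
  have h1 : 0 ≤ M.inflow 1 l := inflow_nonneg (fun _ => zero_le_one) l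
  have h2 := M.arrival_pos l
  have h4 : M.arrival l ≤ M.inflow 1 l := arrival_le_inflow (fun _ => zero_le_one) l
  have h3 := mul_le_mul_of_nonneg_left hs (sub_nonneg.2 hε1)
  have h5 : 0 ≤ δ * ε := mul_nonneg hδ hε0
  have h6 : 0 ≤ δ * ε * (M.inflow 1 l - M.arrival l) := mul_nonneg h5 (sub_nonneg.2 h4)
  have h7 : 0 ≤ δ * M.arrival l := mul_nonneg hδ h2.le
  nlinarith

/-- Subtracting `δ` repairs shipments against demand. Defining the supply as the inflow makes flow
balance exact, and the strict slack puts the matching ratio in `[0, 1)`, inside the range of `F`. -/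
theorem faFeasible_shrink (hε0 : 0 ≤ ε) (hε1 : ε ≤ 1) (hδ : 0 ≤ δ) (hy : ∀ l, 0 ≤ y l)
    (hys : ∀ l, y l ≤ s l) (hyd : ∀ l, y l ≤ d l + δ) (hd : ∀ l, d l ∈ M.demand l '' M.prices l)
    (hlt : ∀ l, (1 - ε) * s l < M.inflow (shrink ε δ y) l) :
    M.FAFeasible d (shrink ε δ y) (M.inflow (shrink ε δ y)) := by
  have hd0 : ∀ l, 0 ≤ d l := fun l => by
    obtain ⟨r, hr, hrd⟩ := hd l
    exact hrd ▸ M.demand_nonneg l r hr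
  have hylt : ∀ l, shrink ε δ y l < M.inflow (shrink ε δ y) l := fun l =>
    ((shrink_le hε1 hδ hy l).trans
      (mul_le_mul_of_nonneg_left (hys l) (sub_nonneg.2 hε1))).trans_lt (hlt l)
  have hpos : ∀ l, 0 < M.inflow (shrink ε δ y) l := fun l =>
    (M.arrival_pos l).trans_le (arrival_le_inflow (fun k => shrink_nonneg hε1 k) l)
  exact
    { flow := fun l => rfl
      y_le_d := fun l => (shrink_le_max hε0 l).trans (max_le (by linarith [hyd l]) (hd0 l))
      y_le_lam := fun l => (hylt l).le
      y_nonneg := fun l => shrink_nonneg hε1 l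
      lam_nonneg := fun l => (hpos l).le
      d_nonneg := hd0
      d_mem := hd
      ratio_mem := fun l => mem_range_distFun (M.density_measurable l) (M.density_nonneg l)
        (M.density_lintegral l) (M.cost_nonneg l)
        (div_nonneg (shrink_nonneg hε1 l) (hpos l).le) ((div_lt_one (hpos l)).2 (hylt l)) }

end FeasiblePoint

/-- Expected payments have an affine minorant in the supply and the expected shipments which, at
`(y, s)`, is at least the fluid payment at any smaller shipment with a smaller matching ratio. -/
theorem IsPolicy.exists_affine_le_meanPayment (hπ : M.IsPolicy π) (hIC : M.IsIC π)
    (hIR : M.IsIR π) (l : Lane E) {y s y' s' : ℝ} (hy' : 0 ≤ y') (hyy' : y' ≤ y) (hys' : y' < s')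
    (hr : y' * s ≤ y * s') :
    ∃ u v : ℝ, (∀ x, u * M.meanShipped π x l + v * x.1 l ≤ M.meanPayment π x l) ∧
      M.invF l (y' / s') * y' ≤ u * y + v * s := by
  -- At ratio zero the quantile need not lie in the support; nonnegativity of payments suffices
  -- instead.
  rcases hy'.eq_or_lt with rfl | hpos
  · exact ⟨0, 0, fun x => by simpa using hπ.meanPayment_nonneg hIR x l, by simp⟩
  have hs' : 0 < s' := hpos.trans hys'
  have hu0 : 0 < y' / s' := div_pos hpos hs'
  have hu1 : y' / s' < 1 := (div_lt_one hs').2 hys'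
  set z := M.invF l (y' / s') with hz
  have hFz : M.F l z = y' / s' := distFun_invDistFun (M.density_measurable l) (M.density_nonneg l)
    (M.density_lintegral l) (M.cost_nonneg l) hu0 hu1
  have hfz : 0 < M.density l z := pos_of_distFun_mem_Ioo (M.density_lintegral l)
    (M.density_interval l) (show M.F l z ∈ Ioo (0 : ℝ) 1 by rw [hFz]; exact ⟨hu0, hu1⟩)
  refine ⟨virtualCost (M.density l) z, (z - virtualCost (M.density l) z) * M.F l z,
    fun x => hπ.tangent_le_meanPayment hIC hIR x l hfz, ?_⟩
  have hψ : z ≤ virtualCost (M.density l) z :=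
    le_add_of_nonneg_right (div_nonneg (distFun_nonneg _ _) hfz.le)
  -- At `(y, s)` the affine bound equals `z y + (ψ(z) - z) (y - F(z) s)`, which is at least `z y ≥ z
  -- y'`.
  have hle : M.F l z * s ≤ y := by
    rw [hFz, div_mul_eq_mul_div, div_le_iff₀ hs']; exact hr
  have h1 := mul_nonneg (sub_nonneg.2 hψ) (sub_nonneg.2 hle)
  have h2 := mul_nonneg (M.cost_nonneg l z hfz) (sub_nonneg.2 hyy')
  nlinarith

theorem IsPolicy.price_mul_demand (hπ : M.IsPolicy π) (x : State E) (l : Lane E) :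
    π.price x l * M.demand l (π.price x l) =
      M.invDemand l (M.demand l (π.price x l)) * M.demand l (π.price x l) := by
  rw [invDemand, (M.demand_strictAnti l).injOn.leftInvOn_invFunOn (hπ.price_mem x l)]

/-! ### Balance equations of the averages -/

section Balance

variable {ν : Measure (State E)} [IsProbabilityMeasure ν]

/-- The inflow at time `t` is the mean supply at `t + 1`, so the sums differ by the initial minus
the final supply, and the latter is dropped. -/
theorem IsPolicy.integral_supply_averageLaw_le (hπ : M.IsPolicy π) (hν : FiniteMeans ν) {T : ℕ}
    (hT : T ≠ 0) (l : Lane E) :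
    ∫ x, (x.1 l : ℝ) ∂averageLaw (M.stateLaw π ν) T ≤
      M.inflow (fun k => ∫ x, M.meanShipped π x k ∂averageLaw (M.stateLaw π ν) T) l +
        (∫ x, (x.1 l : ℝ) ∂ν) / T := by
  have hprob := hπ.isProbabilityMeasure_stateLaw ν
  have hfin := hπ.finiteMeans_stateLaw hν
  have := isProbabilityMeasure_averageLaw (M.stateLaw π ν) hT
  have hY : ∀ k t, Integrable (fun x => M.meanShipped π x k) (M.stateLaw π ν t) := fun k t =>
    hπ.integrable_meanShipped (hfin t) k
  rw [← integral_inflow fun k => integrable_averageLaw hT (hY k),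
    integral_averageLaw fun t => (hfin t).supply l,
    integral_averageLaw fun t => integrable_inflow (fun k => hY k t) l, ← add_div]
  refine div_le_div_of_nonneg_right ?_ (Nat.cast_nonneg T)
  have e1 := Finset.sum_range_succ (fun t => ∫ x, (x.1 l : ℝ) ∂M.stateLaw π ν t) T
  rw [Finset.sum_range_succ'] at e1
  have e2 : ∀ t, ∫ x, M.inflow (M.meanShipped π x) l ∂M.stateLaw π ν t =
      ∫ x, (x.1 l : ℝ) ∂M.stateLaw π ν (t + 1) := fun t => by
    rw [hπ.integral_supply_succ hν, integral_inflow fun k => hY k t]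
  simp_rw [e2]
  have e3 : 0 ≤ ∫ x, (x.1 l : ℝ) ∂M.stateLaw π ν T := integral_nonneg fun x => Nat.cast_nonneg _
  have e4 : ∫ x, (x.1 l : ℝ) ∂M.stateLaw π ν 0 = ∫ x, (x.1 l : ℝ) ∂ν := rfl
  linarith

/-- The difference telescopes to initial minus final mean loads, both in `[0, K]`. A two-sided bound
is needed because the penalty may have either sign. -/
theorem IsPolicy.abs_integral_loads_averageLaw_sub_le (hπ : M.IsPolicy π) (hν : FiniteMeans ν)
    {T : ℕ} (hT : T ≠ 0) (l : Lane E) {K : ℝ} (hK : ∫ x, (x.2 l : ℝ) ∂ν ≤ K)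
    (hB : ∀ x, M.demand l (π.price x l) ≤ K) :
    |∫ x, (x.2 l : ℝ) ∂averageLaw (M.stateLaw π ν) T -
      ∫ x, M.demand l (π.price x l) ∂averageLaw (M.stateLaw π ν) T| ≤ K / T := by
  have hprob := hπ.isProbabilityMeasure_stateLaw ν
  have hfin := hπ.finiteMeans_stateLaw hν
  rw [integral_averageLaw fun t => (hfin t).loads l,
    integral_averageLaw fun t => hπ.integrable_demand _ l, ← sub_div, abs_div, Nat.abs_cast]
  refine div_le_div_of_nonneg_right ?_ (Nat.cast_nonneg T)
  have e1 := Finset.sum_range_succ (fun t => ∫ x, (x.2 l : ℝ) ∂M.stateLaw π ν t) T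
  rw [Finset.sum_range_succ'] at e1
  simp_rw [hπ.integral_loads_succ] at e1
  have e3 : 0 ≤ ∫ x, (x.2 l : ℝ) ∂M.stateLaw π ν T := integral_nonneg fun x => Nat.cast_nonneg _
  have e4 : ∫ x, (x.2 l : ℝ) ∂M.stateLaw π ν 0 = ∫ x, (x.2 l : ℝ) ∂ν := rfl
  have e5 : 0 ≤ ∫ x, (x.2 l : ℝ) ∂ν := integral_nonneg fun x => Nat.cast_nonneg _
  have e6 : ∫ x, (x.2 l : ℝ) ∂M.stateLaw π ν T ≤ K := by
    obtain ⟨n, rfl⟩ := Nat.exists_eq_succ_of_ne_zero hT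
    rw [Nat.succ_eq_add_one, hπ.integral_loads_succ]
    refine (integral_mono (hπ.integrable_demand _ l) (integrable_const K) hB).trans ?_
    simp
  rw [abs_le]
  constructor <;> linarith

end Balance

end Market

/-! ### The finite-horizon bound and the limit -/

namespace Market

variable {N : Type*} [DecidableEq N] {E : Finset (N × N)} {M : Market E} {π : Policy E}

theorem IsPolicy.averageProfit_le_FAObjective (hπ : M.IsPolicy π) (hIC : M.IsIC π)
    (hIR : M.IsIR π) {ν : Measure (State E)} [IsProbabilityMeasure ν] (hν : FiniteMeans ν)
    {K L : ℝ} (hK0 : 0 ≤ K) (hKS : ∀ l, ∫ x, (x.1 l : ℝ) ∂ν ≤ K)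
    (hKD : ∀ l, ∫ x, (x.2 l : ℝ) ∂ν ≤ K) (hKd : ∀ x l, M.demand l (π.price x l) ≤ K)
    (hL0 : 0 ≤ L) (hL : ∀ l, K * (1 + M.inflow 1 l) < L * M.arrival l)
    {T : ℕ} (hT : T ≠ 0) (hLT : L ≤ T) :
    ∃ d y lam : Lane E → ℝ, M.FAFeasible d y lam ∧
      M.averageProfit π ν T ≤
        ((M.FAObjective d y lam + (∑ l, |M.penalty l|) * (2 * K + 2 * K * L) / T : ℝ) : EReal) := by
  have hprob := hπ.isProbabilityMeasure_stateLaw ν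
  have hfin := hπ.finiteMeans_stateLaw hν
  set μ := averageLaw (M.stateLaw π ν) T with hμ
  have hμprob : IsProbabilityMeasure μ := isProbabilityMeasure_averageLaw _ hT
  have hT1 : (1 : ℝ) ≤ T := by exact_mod_cast Nat.one_le_iff_ne_zero.2 hT
  have hTpos : (0 : ℝ) < T := by linarith
  set ε := L / T with hε
  set δ := K / T with hδ
  have hε0 : 0 ≤ ε := div_nonneg hL0 hTpos.le
  have hε1 : ε ≤ 1 := (div_le_one hTpos).2 hLT
  have hδ0 : 0 ≤ δ := div_nonneg hK0 hTpos.le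
  have hδK : δ ≤ K := div_le_self hK0 hT1
  set s : Lane E → ℝ := fun l => ∫ x, (x.1 l : ℝ) ∂μ with hs
  set D : Lane E → ℝ := fun l => ∫ x, (x.2 l : ℝ) ∂μ with hD
  set d : Lane E → ℝ := fun l => ∫ x, M.demand l (π.price x l) ∂μ with hd
  set y : Lane E → ℝ := fun l => ∫ x, M.meanShipped π x l ∂μ with hy
  have iS : ∀ l t, Integrable (fun x : State E => (x.1 l : ℝ)) (M.stateLaw π ν t) :=
    fun l t => (hfin t).supply l
  have iD : ∀ l t, Integrable (fun x : State E => (x.2 l : ℝ)) (M.stateLaw π ν t) :=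
    fun l t => (hfin t).loads l
  have iY : ∀ l t, Integrable (fun x => M.meanShipped π x l) (M.stateLaw π ν t) :=
    fun l t => hπ.integrable_meanShipped (hfin t) l
  have iP : ∀ l t, Integrable (fun x => M.demand l (π.price x l)) (M.stateLaw π ν t) :=
    fun l t => hπ.integrable_demand _ l
  have hy0 : ∀ l, 0 ≤ y l := fun l => integral_nonneg fun x => meanShipped_nonneg π x l
  have hys : ∀ l, y l ≤ s l := fun l =>
    integral_mono (integrable_averageLaw hT (iY l)) (integrable_averageLaw hT (iS l))
      fun x => hπ.meanShipped_le_supply x l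
  have hyD : ∀ l, y l ≤ D l := fun l =>
    integral_mono (integrable_averageLaw hT (iY l)) (integrable_averageLaw hT (iD l))
      fun x => hπ.meanShipped_le_loads x l
  have hDd : ∀ l, |D l - d l| ≤ δ := fun l =>
    hπ.abs_integral_loads_averageLaw_sub_le hν hT l (hKD l) fun x => hKd x l
  have hyd : ∀ l, y l ≤ d l + δ := fun l => by
    linarith [hyD l, (abs_le.1 (hDd l)).2]
  have hdK : ∀ l, d l ≤ K := fun l => by
    refine (integral_mono (integrable_averageLaw hT (iP l)) (integrable_const K)
      fun x => hKd x l).trans ?_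
    simp
  have hsin : ∀ l, s l ≤ M.inflow y l + δ := fun l =>
    (hπ.integral_supply_averageLaw_le hν hT l).trans
      (add_le_add_right (div_le_div_of_nonneg_right (hKS l) hTpos.le) _)
  have hlt : ∀ l, (1 - ε) * s l < M.inflow (shrink ε δ y) l := fun l => by
    refine mul_supply_lt_inflow_shrink hε0 hε1 hδ0 (hsin l) ?_
    rw [hδ, hε, div_mul_eq_mul_div, div_mul_eq_mul_div]
    exact div_lt_div_of_pos_right (hL l) hTpos
  have hjensen := fun l => exists_supporting_line_integral (μ := μ) (M.revenue_concave l)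
    (integrable_averageLaw hT (iP l)) (fun x => mem_image_of_mem _ (hπ.price_mem x l))
  choose hdmem m hm using hjensen
  have hfeas := faFeasible_shrink hε0 hε1 hδ0 hy0 hys hyd hdmem hlt
  refine ⟨d, shrink ε δ y, M.inflow (shrink ε δ y), hfeas, ?_⟩
  have hshr : ∀ l, shrink ε δ y l ≤ (1 - ε) * y l := shrink_le hε1 hδ0 hy0
  have hylt : ∀ l, shrink ε δ y l < M.inflow (shrink ε δ y) l := fun l =>
    ((hshr l).trans (mul_le_mul_of_nonneg_left (hys l) (sub_nonneg.2 hε1))).trans_lt (hlt l)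
  have hshry : ∀ l, shrink ε δ y l ≤ y l := fun l => by
    have := mul_nonneg hε0 (hy0 l)
    linarith [hshr l]
  have hpay := fun l => hπ.exists_affine_le_meanPayment hIC hIR l (s := s l)
    (hfeas.y_nonneg l) (hshry l) (hylt l) (by
      calc shrink ε δ y l * s l ≤ (1 - ε) * y l * s l :=
            mul_le_mul_of_nonneg_right (hshr l) ((hy0 l).trans (hys l))
        _ = y l * ((1 - ε) * s l) := by ring
        _ ≤ _ := mul_le_mul_of_nonneg_left (hlt l).le (hy0 l))
  choose u v huv hfluid using hpay
  -- The affine majorant of the profit on a lane: the supporting line for revenue minus the linear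
  -- lower bound for payments. Its `μ`-integral needs only the means `s`, `D`, `d`, `y`.
  set g : Lane E → State E → ℝ := fun l x =>
    (M.invDemand l (d l) * d l + m l * (M.demand l (π.price x l) - d l)
      - M.penalty l * (x.2 l - M.meanShipped π x l))
      - (u l * M.meanShipped π x l + v l * x.1 l) with hg
  have ig : ∀ l, ∀ ρ : Measure (State E), IsFiniteMeasure ρ →
      Integrable (fun x : State E => (x.1 l : ℝ)) ρ → Integrable (fun x : State E => (x.2 l : ℝ)) ρ →
      Integrable (fun x => M.meanShipped π x l) ρ →
      Integrable (fun x => M.demand l (π.price x l)) ρ → Integrable (g l) ρ := by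
    intro l ρ _ h1 h2 h3 h4
    exact ((((integrable_const _).add ((h4.sub (integrable_const _)).const_mul _)).sub
      ((h2.sub h3).const_mul _)).sub ((h3.const_mul _).add (h1.const_mul _)))
  have hgint : ∀ l, ∫ x, g l x ∂μ = M.invDemand l (d l) * d l - M.penalty l * (D l - y l)
      - (u l * y l + v l * s l) := by
    intro l
    have h1 : Integrable (fun x : State E => (x.1 l : ℝ)) μ := integrable_averageLaw hT (iS l)
    have h2 : Integrable (fun x : State E => (x.2 l : ℝ)) μ := integrable_averageLaw hT (iD l)
    have h3 : Integrable (fun x => M.meanShipped π x l) μ := integrable_averageLaw hT (iY l)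
    have h4 : Integrable (fun x => M.demand l (π.price x l)) μ := integrable_averageLaw hT (iP l)
    simp only [hg]
    rw [integral_sub (by fun_prop) (by fun_prop), integral_sub (by fun_prop) (by fun_prop),
      integral_add (by fun_prop) (by fun_prop), integral_const_mul, integral_const_mul,
      integral_add (by fun_prop) (by fun_prop), integral_const_mul, integral_const_mul,
      integral_sub h4 (by fun_prop), integral_sub h2 h3]
    simp [hs, hD, hd, hy, integral_const_mul]
  have hprofit : ∀ᵐ x ∂μ, M.profit π x ≤ ∑ l, g l x := by
    filter_upwards [ae_all_iff.2 hm] with x hx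
    refine Finset.sum_le_sum fun l _ => ?_
    rw [hπ.price_mul_demand]
    exact sub_le_sub (sub_le_sub_right (hx l) _) (huv l x)
  refine (sum_extExpectation_div_le (fun t => integrable_finsetSum _ fun l _ =>
    ig l _ inferInstance (iS l t) (iD l t) (iY l t) (iP l t)) hprofit).trans ?_
  rw [EReal.coe_le_coe_iff, ← hμ, integral_finsetSum _ fun l _ =>
    ig l μ inferInstance (integrable_averageLaw hT (iS l)) (integrable_averageLaw hT (iD l))
      (integrable_averageLaw hT (iY l)) (integrable_averageLaw hT (iP l)), FAObjective,
    Finset.sum_mul, Finset.sum_div, ← Finset.sum_add_distrib]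
  refine Finset.sum_le_sum fun l _ => ?_
  rw [hgint]
  -- The load balance and the shift by `δ` cost at most `2 * δ`; the scaling costs at most `ε * y l
  -- ≤ ε * (2 * K)`, as `y l ≤ d l + δ ≤ 2 * K`.
  have hgap : |(d l - shrink ε δ y l) - (D l - y l)| ≤ (2 * K + 2 * K * L) / T := by
    have e1 : (2 * K + 2 * K * L) / T = 2 * δ + 2 * K * ε := by rw [hδ, hε]; ring
    rw [e1]
    have h1 := le_shrink (δ := δ) (y := y) hε1 l
    have h2 := hshry l
    have h3 := abs_le.1 (hDd l)
    have h4 : ε * y l ≤ ε * (2 * K) :=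
      mul_le_mul_of_nonneg_left (by linarith [hyd l, hdK l]) hε0
    have h5 := mul_nonneg hε0 hδ0
    have h6 := mul_nonneg hε0 hK0
    rw [abs_le]
    constructor <;> nlinarith
  have hpen : M.penalty l * ((d l - shrink ε δ y l) - (D l - y l)) ≤
      |M.penalty l| * ((2 * K + 2 * K * L) / T) :=
    (le_abs_self _).trans ((abs_mul _ _).trans_le
      (mul_le_mul_of_nonneg_left hgap (abs_nonneg _)))
  rw [← mul_div_assoc] at hpen
  linarith [hfluid l]

theorem IsPolicy.longRunProfit_le_FAValue (hπ : M.IsPolicy π) (hIC : M.IsIC π)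
    (hIR : M.IsIR π) {ν : Measure (State E)} [IsProbabilityMeasure ν] (hν : FiniteMeans ν) :
    M.longRunProfit π ν ≤ M.FAValue := by
  obtain ⟨B, hB⟩ := hπ.demand_bounded
  set K : ℝ := |B| + ∑ l, ∫ x, (x.1 l : ℝ) ∂ν + ∑ l, ∫ x, (x.2 l : ℝ) ∂ν with hK
  have hS0 : ∀ l, 0 ≤ ∫ x, (x.1 l : ℝ) ∂ν := fun l => integral_nonneg fun x => Nat.cast_nonneg _
  have hD0 : ∀ l, 0 ≤ ∫ x, (x.2 l : ℝ) ∂ν := fun l => integral_nonneg fun x => Nat.cast_nonneg _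
  have hSs : 0 ≤ ∑ l, ∫ x, (x.1 l : ℝ) ∂ν := Finset.sum_nonneg fun l _ => hS0 l
  have hDs : 0 ≤ ∑ l, ∫ x, (x.2 l : ℝ) ∂ν := Finset.sum_nonneg fun l _ => hD0 l
  have hB0 := abs_nonneg B
  have hK0 : 0 ≤ K := by linarith
  have hKS : ∀ l, ∫ x, (x.1 l : ℝ) ∂ν ≤ K := fun l => by
    have := Finset.single_le_sum (fun k _ => hS0 k) (Finset.mem_univ l)
    linarith
  have hKD : ∀ l, ∫ x, (x.2 l : ℝ) ∂ν ≤ K := fun l => by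
    have := Finset.single_le_sum (fun k _ => hD0 k) (Finset.mem_univ l)
    linarith
  have hKd : ∀ x l, M.demand l (π.price x l) ≤ K := fun x l => by
    linarith [hB x l, le_abs_self B]
  have hq0 : ∀ l, 0 ≤ K * (1 + M.inflow 1 l) / M.arrival l := fun l =>
    div_nonneg (mul_nonneg hK0 (add_nonneg zero_le_one (inflow_nonneg (fun _ => zero_le_one) l)))
      (M.arrival_pos l).le
  -- With `ε = L / T` and `δ = K / T`, this is large enough for the slack condition on all lanes at
  -- once; the extra `1` makes it strict.
  set L : ℝ := 1 + ∑ l, K * (1 + M.inflow 1 l) / M.arrival l with hLdef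
  have hL0 : 0 ≤ L := add_nonneg zero_le_one (Finset.sum_nonneg fun l _ => hq0 l)
  have hL : ∀ l, K * (1 + M.inflow 1 l) < L * M.arrival l := fun l => by
    rw [← div_lt_iff₀ (M.arrival_pos l)]
    have := Finset.single_le_sum (fun k _ => hq0 k) (Finset.mem_univ l)
    linarith
  set c : ℝ := (∑ l, |M.penalty l|) * (2 * K + 2 * K * L) with hc
  have hev : ∀ᶠ T : ℕ in atTop, T ≠ 0 ∧ L ≤ T :=
    (eventually_ne_atTop 0).and (tendsto_natCast_atTop_atTop.eventually_ge_atTop L)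
  -- The feasible point built for large `T` also shows that the program is feasible, which excludes
  -- the value `⊥` of an empty supremum.
  have key : ∀ T : ℕ, T ≠ 0 → L ≤ T → M.FAValue ≠ ⊥ ∧
      M.averageProfit π ν T ≤ M.FAValue + ((c / T : ℝ) : EReal) := by
    intro T hT hLT
    obtain ⟨d, y, lam, hf, hle⟩ :=
      hπ.averageProfit_le_FAObjective hIC hIR hν hK0 hKS hKD hKd hL0 hL hT hLT
    have hval : (M.FAObjective d y lam : EReal) ≤ M.FAValue := le_sSup ⟨d, y, lam, hf, rfl⟩
    refine ⟨fun h => ?_, hle.trans ?_⟩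
    · rw [h, le_bot_iff] at hval
      exact EReal.coe_ne_bot _ hval
    · rw [EReal.coe_add]
      exact add_le_add_left hval _
  obtain ⟨T₀, hT₀⟩ := hev.exists
  have hbot := (key T₀ hT₀.1 hT₀.2).1
  rcases eq_or_ne M.FAValue ⊤ with htop | htop
  · rw [htop]; exact le_top
  lift M.FAValue to ℝ using ⟨htop, hbot⟩ with w hw
  have hlim : Tendsto (fun T : ℕ => ((w + c / T : ℝ) : EReal)) atTop (nhds (w : EReal)) := by
    refine (continuous_coe_real_ereal.tendsto w).comp ?_
    simpa using (tendsto_const_div_atTop_nhds_zero_nat c).const_add w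
  refine (limsup_le_limsup ?_).trans hlim.limsup_eq.le
  filter_upwards [hev] with T hT
  rw [EReal.coe_add]
  exact (key T hT.1 hT.2).2

end Market

end Freight

end

theorem theorem1 {N : Type*} [DecidableEq N] {E : Finset (N × N)}
    (M : Freight.Market E) (π : Freight.Policy E) (hπ : M.IsPolicy π)
    (hIC : M.IsIC π) (hIR : M.IsIR π)
    (ν : MeasureTheory.Measure (Freight.State E)) [MeasureTheory.IsProbabilityMeasure ν]
    (hS : ∀ l, MeasureTheory.Integrable (fun x : Freight.State E => (x.1 l : ℝ)) ν)
    (hD : ∀ l, MeasureTheory.Integrable (fun x : Freight.State E => (x.2 l : ℝ)) ν) :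
    M.longRunProfit π ν ≤ M.FAValue :=
  hπ.longRunProfit_le_FAValue hIC hIR ⟨hS, hD⟩
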